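/- Let $R$ be a Noetherian local ring. Let $F_1,\dots,F_q$ be free $R$-modules of finite rank, with endomorphisms $\phi_k\colon F_k\to F_k$. Let $K_\bullet(\phi_k)$ be the complex $0\to F_k\xrightarrow{\phi_k}F_k\to0$ in degrees $1$ and $0$, and put $K_\bullet(\phi_1,\dots,\phi_q)=K_\bullet(\phi_1)\otimes_R\cdots\otimes_R K_\bullet(\phi_q)$. For $x_1,\dots,x_q\in R$ let $K_\bullet(x_1,\dots,x_q)$ be the Koszul complex, i.e. the case in which $F_k=R$ and $\phi_k$ is multiplication by $x_k$. Write $\lambda$ for length. For a bounded complex $C$ whose homology modules have finite length, put $\chi(C)=\sum_i(-1)^i\lambda(H_i(C))$. 1. All homology modules of $K_\bullet(\phi_1,\dots,\phi_q)$ have finite length if and only if $R/(\det\phi_1,\dots,\det\phi_q)$ has finite length. 2. If these equivalent conditions hold, then the homology modules of $K_\bullet(\det\phi_1,\dots,\det\phi_q)$ also have finite length, and $$\chi\bigl(K_\bullet(\phi_1,\dots,\phi_q)\bigr)=\chi\bigl(K_\bullet(\det\phi_1,\dots,\det\phi_q)\bigr).$$ 3. If moreover $R$ is Cohen–Macaulay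 and $q=\dim R$, then both complexes are acyclic (their homology vanishes in all positive degrees), and $$\lambda\bigl(H_0(K_\bullet(\phi_1,\dots,\phi_q))\bigr)=\lambda\bigl(R/(\det\phi_1,\dots,\det\phi_q)\bigr).$$ -/

import Mathlib

open CategoryTheory MonoidalCategory

universe u

noncomputable section

/-- The two-term complex `0 ⟶ F ⟶ F ⟶ 0` with differential `φ`, placed in degrees `1` and `0`. -/
def endoComplex {R : Type u} [CommRing R] {F : Type u} [AddCommGroup F] [Module R F]
    (φ : F →ₗ[R] F) : ChainComplex (ModuleCat.{u} R) ℕ :=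
  HomologicalComplex.double (c := ComplexShape.down ℕ) (i₀ := 1) (i₁ := 0)
    (ModuleCat.ofHom φ) (by simp)

/-- The tensor product `K(φ₁) ⊗ (K(φ₂) ⊗ (⋯ ⊗ K(φ_q)))` of complexes of `R`-modules.
The empty tensor product is the unit, that is, `R` in degree `0`. -/
def tensorEndoComplex {R : Type u} [CommRing R] {q : ℕ} {F : Fin q → Type u}
    [∀ k, AddCommGroup (F k)] [∀ k, Module R (F k)] (φ : ∀ k, F k →ₗ[R] F k) :
    ChainComplex (ModuleCat.{u} R) ℕ :=
  (List.ofFn fun k => endoComplex (φ k)).foldr (fun K L => K ⊗ L)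
    (𝟙_ (ChainComplex (ModuleCat.{u} R) ℕ))

/-- The Koszul complex of a sequence of elements of `R`: the tensor product of the complexes
`0 ⟶ R ⟶ R ⟶ 0` given by multiplication by `x k`. -/
def koszulComplex {R : Type u} [CommRing R] {q : ℕ} (x : Fin q → R) :
    ChainComplex (ModuleCat.{u} R) ℕ :=
  tensorEndoComplex (F := fun _ => R) fun k => LinearMap.mulLeft R (x k)

/-- All homology modules have finite length. -/
def HasFiniteLengthHomology {R : Type u} [CommRing R]
    (K : ChainComplex (ModuleCat.{u} R) ℕ) : Prop :=
  ∀ i, IsFiniteLength R (K.homology i)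

/-- The alternating sum of the lengths of the homology modules, meaningful for a bounded complex
whose homology modules have finite length. -/
def eulerPoincareChar {R : Type u} [CommRing R]
    (K : ChainComplex (ModuleCat.{u} R) ℕ) : ℤ :=
  ∑ᶠ i : ℕ, (-1 : ℤ) ^ i * ((Module.length R (K.homology i)).toNat : ℤ)

/-- The homology vanishes in all positive degrees. -/
def IsAcyclicInPosDegrees {R : Type u} [CommRing R]
    (K : ChainComplex (ModuleCat.{u} R) ℕ) : Prop :=
  ∀ i, 0 < i → K.ExactAt i

/-- The depth of a local ring: the supremum of the lengths of the regular sequences contained in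
its maximal ideal. -/
def localRingDepth (R : Type u) [CommRing R] [IsLocalRing R] : ℕ∞ :=
  ⨆ rs : {rs : List R // (∀ r ∈ rs, r ∈ IsLocalRing.maximalIdeal R) ∧
    RingTheory.Sequence.IsRegular R rs}, (rs.1.length : ℕ∞)

/-- A local ring (used for Noetherian ones) is Cohen-Macaulay if its depth equals its Krull
dimension. -/
def IsCohenMacaulayLocal (R : Type u) [CommRing R] [IsLocalRing R] : Prop :=
  (localRingDepth R : WithBot ℕ∞) = ringKrullDim R

end

/-! Tensoring with K(φ) is forming a cone. In a basis φ is a matrix A, which acts on N^m for every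
R-module N, and H_n(K(φ) ⊗ L) is an extension of ker(A on H_{n-1}(L)^m) by coker(A on H_n(L)^m)
(`endoComplex.exists_exact_homology`). `IsConeOfDet` retains only this extension and det A, so that
φ_k and multiplication by det φ_k are treated on the same footing.

Finite length is a question of support. Since det A kills kernel and cokernel, every determinant is
nilpotent on the homology. Conversely a prime in the support of N that contains det A is in the
support of coker(A on N^m) (`annihilator_coker_matAct_le`), so a prime containing all determinants
is in the support of H_0.

For χ, the extensions give χ(K ⊗ L) = ∑ (-1)^n index(A on H_n(L)^m), where index is length of
cokernel minus length of kernel. The index depends only on det A (`lengthIndex_matAct_eq`): it is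
additive in N by the snake lemma, so N may be taken to be R/p. The essential case is a domain of
dimension at most 1, where length(coker A) = ord(det A), because both sides are additive in A, agree
on diagonal matrices and vanish on transvections, and these generate GL over the fraction field. The
factors are then exchanged one at a time, by commutativity of the tensor product.

In the Cohen–Macaulay case choose a regular sequence y of length at least q in the maximal ideal. If
H_i ≠ 0 for some i > 0, each y_j is nilpotent on the homology, so tensoring with K(y_j) moves
nonzero homology up one degree, and K(y) ⊗ K(φ) has homology in degree i + |y| > q. But K(y) has
homology only in degree 0, and tensoring it with q cones gives none above degree q. Acyclicity makes
χ the length of H_0. -/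

/-! ### Matrices acting on powers of a module. -/

noncomputable section

/-- The action of a matrix over `R` on tuples of elements of an `R`-module. -/
def matAct {R : Type*} [CommRing R] {m n : Type*} [Fintype n] (N : Type*) [AddCommGroup N]
    [Module R N] (A : Matrix m n R) : (n → N) →ₗ[R] (m → N) :=
  LinearMap.pi fun i => ∑ j, A i j • LinearMap.proj j

namespace matAct

variable {R : Type*} [CommRing R] {l m n : Type*} [Fintype n]
  (N : Type*) [AddCommGroup N] [Module R N]

@[simp]
lemma apply (A : Matrix m n R) (v : n → N) (i : m) : matAct N A v i = ∑ j, A i j • v j := by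
  simp [matAct]

lemma mul [Fintype m] (A : Matrix l m R) (B : Matrix m n R) :
    matAct N (A * B) = matAct N A ∘ₗ matAct N B := by
  refine LinearMap.ext fun v => funext fun i => ?_
  simp only [LinearMap.comp_apply, apply, Matrix.mul_apply, Finset.sum_smul, Finset.smul_sum,
    mul_smul]
  exact Finset.sum_comm

lemma diagonal [DecidableEq n] (d : n → R) (v : n → N) (i : n) :
    matAct N (Matrix.diagonal d) v i = d i • v i := by
  simp [Matrix.diagonal_apply, ite_smul]

lemma scalar [DecidableEq n] (r : R) (v : n → N) : matAct N (r • (1 : Matrix n n R)) v = r • v := by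
  rw [Matrix.smul_one_eq_diagonal]
  exact funext fun i => diagonal ..

lemma map_comp {N' : Type*} [AddCommGroup N'] [Module R N'] (f : N →ₗ[R] N') (A : Matrix m n R)
    (v : n → N) : matAct N' A (f ∘ v) = f ∘ matAct N A v := by
  funext i
  simp

end matAct
end

/-! ### Symmetry and degreewise split exactness of tensor products of complexes. -/

noncomputable section

/-- The sign `(-1) ^ (p * q)` of the symmetry of the tensor product of chain complexes. -/
instance : TotalComplexShapeSymmetry (ComplexShape.down ℕ) (ComplexShape.down ℕ)
    (ComplexShape.down ℕ) where
  symm p q := add_comm q p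
  σ p q := (-1) ^ (p * q)
  σ_ε₁ := by
    rintro _ p rfl q
    change (-1 : ℤˣ) ^ ((p + 1) * q) * 1 = (-1) ^ q * (-1) ^ (p * q)
    rw [mul_one, ← pow_add]
    ring_nf
  σ_ε₂ := by
    rintro p _ q rfl
    change (-1 : ℤˣ) ^ (p * (q + 1)) * (-1) ^ p = 1 * (-1) ^ (p * q)
    rw [one_mul, ← pow_add, mul_add, mul_one, add_assoc, ← two_mul, pow_add, pow_mul _ 2]
    simp

variable {R : Type u} [CommRing R]

/-- The tensor product as the total complex of the flipped tensor bifunctor. -/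
def flipTensorIso (K L : ChainComplex (ModuleCat.{u} R) ℕ) :
    (((curriedTensor (ModuleCat.{u} R)).flip.mapBifunctorHomologicalComplex
      (ComplexShape.down ℕ) (ComplexShape.down ℕ)).obj K).obj L ≅
    (((curriedTensor (ModuleCat.{u} R)).mapBifunctorHomologicalComplex
      (ComplexShape.down ℕ) (ComplexShape.down ℕ)).obj K).obj L :=
  HomologicalComplex.Hom.isoOfComponents
    (fun i => HomologicalComplex.Hom.isoOfComponents (fun j => β_ (L.X j) (K.X i))
      (fun j j' _ =>
        (BraidedCategory.braiding_naturality_left (L.d j j') (K.X i)).symm))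
    (fun i i' _ => by
      ext1 j
      exact (BraidedCategory.braiding_naturality_right (L.X j) (K.d i i')).symm)

/-- The symmetry of the tensor product of chain complexes. -/
def tensorCommIso (K L : ChainComplex (ModuleCat.{u} R) ℕ) : K ⊗ L ≅ L ⊗ K :=
  (HomologicalComplex₂.total.mapIso (flipTensorIso K L) (ComplexShape.down ℕ)).symm ≪≫
    (HomologicalComplex.mapBifunctorFlipIso L K (curriedTensor (ModuleCat.{u} R))
      (ComplexShape.down ℕ))

/-- The tensor product of a list of complexes. -/
def foldTensor (l : List (ChainComplex (ModuleCat.{u} R) ℕ)) : ChainComplex (ModuleCat.{u} R) ℕ :=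
  l.foldr (fun K L => K ⊗ L) (𝟙_ (ChainComplex (ModuleCat.{u} R) ℕ))

/-- Adjacent transpositions come from associativity and symmetry. Mere existence of an isomorphism
is enough, as only lengths and vanishing of homology are compared. -/
lemma foldTensor_perm {l l' : List (ChainComplex (ModuleCat.{u} R) ℕ)} (h : l.Perm l') :
    Nonempty (foldTensor l ≅ foldTensor l') := by
  induction h with
  | nil => exact ⟨Iso.refl _⟩
  | cons K _ ih => exact ⟨whiskerLeftIso K ih.some⟩
  | swap K L l =>
    exact ⟨(α_ L K (foldTensor l)).symm ≪≫ whiskerRightIso (tensorCommIso L K) _ ≪≫ α_ _ _ _⟩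
  | trans _ _ ih₁ ih₂ => exact ⟨ih₁.some ≪≫ ih₂.some⟩

lemma homologyMap_smul {K L : ChainComplex (ModuleCat.{u} R) ℕ} (f : K ⟶ L) (r : R) (n : ℕ) :
    HomologicalComplex.homologyMap (r • f) n = r • HomologicalComplex.homologyMap f n :=
  ShortComplex.homologyMap_smul ((HomologicalComplex.shortComplexFunctor _ _ n).map f) r

lemma tensor_hom_ext {K L : ChainComplex (ModuleCat.{u} R) ℕ} {n : ℕ} {Y : ModuleCat.{u} R}
    {f g : (K ⊗ L).X n ⟶ Y}
    (h : ∀ (i j : ℕ) (h : i + j = n), HomologicalComplex.ιTensorObj K L i j n h ≫ f =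
      HomologicalComplex.ιTensorObj K L i j n h ≫ g) : f = g :=
  HomologicalComplex.mapBifunctor.hom_ext h

lemma ι_whiskerRight {K K' : ChainComplex (ModuleCat.{u} R) ℕ} (f : K ⟶ K')
    (L : ChainComplex (ModuleCat.{u} R) ℕ) (i j n : ℕ) (h : i + j = n) :
    HomologicalComplex.ιTensorObj K L i j n h ≫ (f ▷ L).f n =
      (f.f i ▷ L.X j) ≫ HomologicalComplex.ιTensorObj K' L i j n h := by
  refine (HomologicalComplex.ι_mapBifunctorMap f (𝟙 L) (curriedTensor (ModuleCat.{u} R)) _ i j n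
    h).trans ?_
  simp

lemma ι_whiskerRight_assoc {K K' : ChainComplex (ModuleCat.{u} R) ℕ} (f : K ⟶ K')
    (L : ChainComplex (ModuleCat.{u} R) ℕ) (i j n : ℕ) (h : i + j = n) {Z : ModuleCat.{u} R}
    (k : (K' ⊗ L).X n ⟶ Z) :
    HomologicalComplex.ιTensorObj K L i j n h ≫ (f ▷ L).f n ≫ k =
      (f.f i ▷ L.X j) ≫ HomologicalComplex.ιTensorObj K' L i j n h ≫ k := by
  have := congrArg (· ≫ k) (ι_whiskerRight f L i j n h)
  simpa only [Category.assoc] using this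

lemma add_whiskerRight' {K K' : ChainComplex (ModuleCat.{u} R) ℕ} (f g : K ⟶ K')
    (L : ChainComplex (ModuleCat.{u} R) ℕ) : (f + g) ▷ L = f ▷ L + g ▷ L := by
  ext1 n
  refine tensor_hom_ext fun i j h => ?_
  simp [ι_whiskerRight, Preadditive.comp_add, MonoidalPreadditive.add_whiskerRight]

lemma smul_whiskerRight' {K K' : ChainComplex (ModuleCat.{u} R) ℕ} (f : K ⟶ K') (r : R)
    (L : ChainComplex (ModuleCat.{u} R) ℕ) : (r • f) ▷ L = r • (f ▷ L) := by
  ext1 n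
  refine tensor_hom_ext fun i j h => ?_
  simp [ι_whiskerRight]

instance (L : ChainComplex (ModuleCat.{u} R) ℕ) : (tensorRight L).Additive where
  map_add := add_whiskerRight' _ _ L

/-- The graded map `φ ⊗ L` of a graded map `φ` that need not commute with the differentials. -/
def gradedWhiskerRight {K K' : ChainComplex (ModuleCat.{u} R) ℕ} (φ : ∀ i, K.X i ⟶ K'.X i)
    (L : ChainComplex (ModuleCat.{u} R) ℕ) (n : ℕ) : (K ⊗ L).X n ⟶ (K' ⊗ L).X n :=
  HomologicalComplex.mapBifunctorDesc (K₁ := K) (K₂ := L) (F := curriedTensor (ModuleCat.{u} R))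
    (c := ComplexShape.down ℕ)
    fun i j h => (φ i ▷ L.X j) ≫ HomologicalComplex.ιTensorObj K' L i j n h

lemma ι_gradedWhiskerRight {K K' : ChainComplex (ModuleCat.{u} R) ℕ} (φ : ∀ i, K.X i ⟶ K'.X i)
    (L : ChainComplex (ModuleCat.{u} R) ℕ) (i j n : ℕ) (h : i + j = n) :
    HomologicalComplex.ιTensorObj K L i j n h ≫ gradedWhiskerRight φ L n =
      (φ i ▷ L.X j) ≫ HomologicalComplex.ιTensorObj K' L i j n h :=
  HomologicalComplex.ι_mapBifunctorDesc ..

lemma ι_gradedWhiskerRight_assoc {K K' : ChainComplex (ModuleCat.{u} R) ℕ}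
    (φ : ∀ i, K.X i ⟶ K'.X i) (L : ChainComplex (ModuleCat.{u} R) ℕ) (i j n : ℕ) (h : i + j = n)
    {Z : ModuleCat.{u} R} (k : (K' ⊗ L).X n ⟶ Z) :
    HomologicalComplex.ιTensorObj K L i j n h ≫ gradedWhiskerRight φ L n ≫ k =
      (φ i ▷ L.X j) ≫ HomologicalComplex.ιTensorObj K' L i j n h ≫ k := by
  have := congrArg (· ≫ k) (ι_gradedWhiskerRight φ L i j n h)
  simpa only [Category.assoc] using this

/-- A splitting in each degree survives any additive functor, so no flatness of L is needed. The
splitting need not commute with the differentials, which is why it is transported by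
`gradedWhiskerRight`. -/
lemma shortExact_whiskerRight {K₁ K₂ K₃ : ChainComplex (ModuleCat.{u} R) ℕ}
    (f : K₁ ⟶ K₂) (g : K₂ ⟶ K₃) (r : ∀ i, K₂.X i ⟶ K₁.X i) (s : ∀ i, K₃.X i ⟶ K₂.X i)
    (hfr : ∀ i, f.f i ≫ r i = 𝟙 _) (hsg : ∀ i, s i ≫ g.f i = 𝟙 _)
    (hid : ∀ i, r i ≫ f.f i + g.f i ≫ s i = 𝟙 _) (L : ChainComplex (ModuleCat.{u} R) ℕ)
    (w : f ▷ L ≫ g ▷ L = 0) :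
    (ShortComplex.mk (f ▷ L) (g ▷ L) w).ShortExact := by
  refine HomologicalComplex.shortExact_of_degreewise_shortExact _ fun n => ?_
  have h₁ : (f ▷ L).f n ≫ gradedWhiskerRight r L n = 𝟙 _ := by
    refine tensor_hom_ext fun i j h => ?_
    rw [ι_whiskerRight_assoc, ι_gradedWhiskerRight, ← comp_whiskerRight_assoc, hfr]
    rw [id_whiskerRight, Category.id_comp]
    exact (Category.comp_id _).symm
  have h₂ : gradedWhiskerRight s L n ≫ (g ▷ L).f n = 𝟙 _ := by
    refine tensor_hom_ext fun i j h => ?_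
    rw [ι_gradedWhiskerRight_assoc, ι_whiskerRight, ← comp_whiskerRight_assoc, hsg]
    rw [id_whiskerRight, Category.id_comp]
    exact (Category.comp_id _).symm
  have h₃ : gradedWhiskerRight r L n ≫ (f ▷ L).f n + (g ▷ L).f n ≫ gradedWhiskerRight s L n =
      𝟙 _ := by
    refine tensor_hom_ext fun i j h => ?_
    rw [Preadditive.comp_add, ι_whiskerRight_assoc, ι_gradedWhiskerRight_assoc,
      ι_gradedWhiskerRight, ι_whiskerRight, ← comp_whiskerRight_assoc, ← comp_whiskerRight_assoc,
      ← Preadditive.add_comp, ← MonoidalPreadditive.add_whiskerRight, hid]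
    rw [id_whiskerRight, Category.id_comp]
    exact (Category.comp_id _).symm
  exact ShortComplex.Splitting.shortExact
    { r := gradedWhiskerRight r L n, s := gradedWhiskerRight s L n, f_r := h₁, s_g := h₂, id := h₃ }

end

/-! ### The two-term complex as an extension of F[1] by F. -/

noncomputable section

open HomologicalComplex

variable {R : Type u} [CommRing R] {F : Type u} [AddCommGroup F] [Module R F]

variable (R F) in
/-- The complex with the module `F` in degree `n`. -/
abbrev singleDeg (n : ℕ) : ChainComplex (ModuleCat.{u} R) ℕ :=
  (single (ModuleCat.{u} R) (ComplexShape.down ℕ) n).obj (ModuleCat.of R F)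

namespace endoComplex

variable (φ : F →ₗ[R] F)

/-- The term of degree `1` of `endoComplex φ`. -/
def xOne : (endoComplex φ).X 1 ≅ ModuleCat.of R F := doubleXIso₀ _ _

/-- The term of degree `0` of `endoComplex φ`. -/
def xZero : (endoComplex φ).X 0 ≅ ModuleCat.of R F := doubleXIso₁ _ _ one_ne_zero

lemma d_one_zero : (endoComplex φ).d 1 0 = (xOne φ).hom ≫ ModuleCat.ofHom φ ≫ (xZero φ).inv :=
  double_d _ _ one_ne_zero

lemma d_two_one : (endoComplex φ).d 2 1 = 0 := double_d_eq_zero₀ _ _ _ _ (by simp)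

lemma isZero_X (n : ℕ) : Limits.IsZero ((endoComplex φ).X (n + 2)) :=
  isZero_double_X _ _ _ (by lia) (by lia)

/-- The inclusion of the term of degree `0`. -/
def incl : singleDeg R F 0 ⟶ endoComplex φ :=
  mkHomFromSingle (xZero φ).inv (by simp)

/-- The projection onto the term of degree `1`. -/
def proj : endoComplex φ ⟶ singleDeg R F 1 :=
  mkHomToSingle (xOne φ).hom (fun i hi => by
    obtain rfl : i = 2 := by simpa using hi.symm
    rw [d_two_one, Limits.zero_comp])

lemma incl_proj : incl φ ≫ proj φ = 0 := by
  ext1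
  rw [HomologicalComplex.comp_f]
  exact (isZero_single_obj_X _ _ _ _ (by simp)).eq_of_tgt _ _

lemma exists_splitting (i : ℕ) :
    ∃ (r : (endoComplex φ).X i ⟶ (singleDeg R F 0).X i)
      (s : (singleDeg R F 1).X i ⟶ (endoComplex φ).X i),
      (incl φ).f i ≫ r = 𝟙 _ ∧ s ≫ (proj φ).f i = 𝟙 _ ∧
        r ≫ (incl φ).f i + (proj φ).f i ≫ s = 𝟙 _ := by
  match i with
  | 0 =>
    have h := isZero_single_obj_X (ComplexShape.down ℕ) 1 (ModuleCat.of R F) 0 (by simp)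
    refine ⟨(xZero φ).hom ≫ (singleObjXSelf _ 0 _).inv, 0, ?_, h.eq_of_src _ _, ?_⟩
    · simp [incl]
    · simp [incl]
  | 1 =>
    have h := isZero_single_obj_X (ComplexShape.down ℕ) 0 (ModuleCat.of R F) 1 (by simp)
    refine ⟨0, (singleObjXSelf _ 1 _).hom ≫ (xOne φ).inv, h.eq_of_src _ _, ?_, ?_⟩
    · simp [proj]
    · simp [proj]
  | n + 2 =>
    exact ⟨0, 0, (isZero_single_obj_X _ _ _ _ (by simp)).eq_of_src _ _,
      (isZero_single_obj_X _ _ _ _ (by simp)).eq_of_src _ _, (isZero_X φ n).eq_of_src _ _⟩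

variable (L : ChainComplex (ModuleCat.{u} R) ℕ)

lemma incl_proj_whiskerRight : incl φ ▷ L ≫ proj φ ▷ L = 0 := by
  rw [← comp_whiskerRight, incl_proj]
  exact (tensorRight L).map_zero _ _

/-- The sequence `F ⊗ L ⟶ endoComplex φ ⊗ L ⟶ F[1] ⊗ L`. -/
abbrev tensorSeq : ShortComplex (ChainComplex (ModuleCat.{u} R) ℕ) :=
  ShortComplex.mk (incl φ ▷ L) (proj φ ▷ L) (incl_proj_whiskerRight φ L)

lemma tensorSeq_shortExact : (tensorSeq φ L).ShortExact := by
  choose r s h₁ h₂ h₃ using exists_splitting φ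
  exact shortExact_whiskerRight (incl φ) (proj φ) r s h₁ h₂ h₃ L _

/-- The map from the complex of the identity that is `φ` in degree `0` and `id` in degree `1`. -/
def fromId : endoComplex (LinearMap.id : F →ₗ[R] F) ⟶ endoComplex φ :=
  mkHomFromDouble _ one_ne_zero (xOne φ).inv (ModuleCat.ofHom φ ≫ (xZero φ).inv)
    (by rw [d_one_zero]; simp) (by simp)

lemma incl_fromId : incl LinearMap.id ≫ fromId φ =
    (single _ _ 0).map (ModuleCat.ofHom φ) ≫ incl φ := by
  apply from_single_hom_ext
  have : (fromId φ).f 0 = (xZero _).hom ≫ ModuleCat.ofHom φ ≫ (xZero φ).inv :=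
    mkHomFromDouble_f₁ ..
  simp [incl, this]

lemma fromId_proj : fromId φ ≫ proj φ = proj LinearMap.id := by
  apply to_single_hom_ext
  have : (fromId φ).f 1 = (xOne _).hom ≫ (xOne φ).inv := mkHomFromDouble_f₀ ..
  simp [proj, this]

/-- The map of sequences induced by `fromId φ`. -/
def tensorSeqHom : tensorSeq (LinearMap.id : F →ₗ[R] F) L ⟶ tensorSeq φ L where
  τ₁ := (single _ _ 0).map (ModuleCat.ofHom φ) ▷ L
  τ₂ := fromId φ ▷ L
  τ₃ := 𝟙 _
  comm₁₂ := by
    dsimp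
    rw [← comp_whiskerRight, ← comp_whiskerRight, incl_fromId]
  comm₂₃ := by
    dsimp
    rw [← comp_whiskerRight, fromId_proj, Category.comp_id]

variable (R F) in
/-- The components of the contracting homotopy of `endoComplex id`. -/
def contraction (i j : ℕ) (_ : (ComplexShape.down ℕ).Rel j i) :
    (endoComplex (LinearMap.id : F →ₗ[R] F)).X i ⟶ (endoComplex (LinearMap.id : F →ₗ[R] F)).X j :=
  match i, j with
  | 0, 1 => (xZero _).hom ≫ (xOne _).inv
  | _, _ => 0

variable (R F) in
lemma contraction_comm_one : (endoComplex (LinearMap.id : F →ₗ[R] F)).d 1 0 ≫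
    contraction R F 0 1 rfl + contraction R F 1 2 rfl ≫ (endoComplex LinearMap.id).d 2 1 = 𝟙 _ := by
  rw [d_two_one, Limits.comp_zero, add_zero, d_one_zero]
  change _ ≫ (xZero _).hom ≫ (xOne _).inv = _
  simp

variable (R F) in
lemma contraction_comm_zero :
    contraction R F 0 1 rfl ≫ (endoComplex (LinearMap.id : F →ₗ[R] F)).d 1 0 = 𝟙 _ := by
  rw [d_one_zero]
  change ((xZero _).hom ≫ (xOne _).inv) ≫ _ = _
  simp

variable (R F) in
/-- The complex `endoComplex id` is contractible. -/
def idHomotopy : Homotopy (𝟙 (endoComplex (LinearMap.id : F →ₗ[R] F))) 0 :=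
  (Homotopy.ofEq (by
    apply from_double_hom_ext
    · exact ((Homotopy.nullHomotopicMap'_f (k₂ := 2) (k₁ := 1) (k₀ := 0) rfl rfl
        (contraction R F)).trans (contraction_comm_one R F)).symm
    · exact ((Homotopy.nullHomotopicMap'_f_of_not_rel_left (k₁ := 1) (k₀ := 0) rfl
        (by simp) (contraction R F)).trans (contraction_comm_zero R F)).symm)).trans
  (Homotopy.nullHomotopy' (contraction R F))

lemma isZero_homology_id (n : ℕ) :
    Limits.IsZero ((endoComplex (LinearMap.id : F →ₗ[R] F) ⊗ L).homology n) := by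
  let K : ChainComplex (ModuleCat.{u} R) ℕ := endoComplex (LinearMap.id : F →ₗ[R] F)
  have h : homologyMap (𝟙 K ▷ L) n = homologyMap ((0 : K ⟶ K) ▷ L) n :=
    (mapBifunctorMapHomotopy₁ (idHomotopy R F) (𝟙 L)
      (curriedTensor (ModuleCat.{u} R)) (ComplexShape.down ℕ)).homologyMap_eq n
  have h₀ : (0 : K ⟶ K) ▷ L = 0 := (tensorRight L).map_zero _ _
  rw [h₀, id_whiskerRight, homologyMap_id, homologyMap_zero] at h
  rwa [Limits.IsZero.iff_id_eq_zero]

end endoComplex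
end

/-! ### The homology of K(φ) ⊗ L. -/

noncomputable section

open HomologicalComplex

variable {R : Type u} [CommRing R]

/-- The map induced by `f` on the `n`-th homology of the tensor product of a module, placed in
degree `0`, with the complex `L`. -/
def singleTensorHomologyMap (L : ChainComplex (ModuleCat.{u} R) ℕ) (n : ℕ) {M N : Type u}
    [AddCommGroup M] [Module R M] [AddCommGroup N] [Module R N] (f : M →ₗ[R] N) :
    (singleDeg R M 0 ⊗ L).homology n →ₗ[R] (singleDeg R N 0 ⊗ L).homology n :=
  (homologyMap ((single _ _ 0).map (ModuleCat.ofHom f) ▷ L) n).hom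

section

variable (L : ChainComplex (ModuleCat.{u} R) ℕ) (n : ℕ) {M N P : Type u}
    [AddCommGroup M] [Module R M] [AddCommGroup N] [Module R N] [AddCommGroup P] [Module R P]

lemma singleTensorHomologyMap_comp (f : M →ₗ[R] N) (g : N →ₗ[R] P) :
    singleTensorHomologyMap L n (g ∘ₗ f) =
      singleTensorHomologyMap L n g ∘ₗ singleTensorHomologyMap L n f := by
  simp only [singleTensorHomologyMap, ModuleCat.ofHom_comp, Functor.map_comp, comp_whiskerRight,
    homologyMap_comp, ModuleCat.hom_comp]

lemma singleTensorHomologyMap_id :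
    singleTensorHomologyMap L n (LinearMap.id : M →ₗ[R] M) = LinearMap.id := by
  have : (single (ModuleCat.{u} R) (ComplexShape.down ℕ) 0).map
      (ModuleCat.ofHom (LinearMap.id : M →ₗ[R] M)) = 𝟙 (singleDeg R M 0) :=
    (single (ModuleCat.{u} R) (ComplexShape.down ℕ) 0).map_id _
  rw [singleTensorHomologyMap, this, id_whiskerRight, homologyMap_id, ModuleCat.hom_id]

lemma singleTensorHomologyMap_add (f g : M →ₗ[R] N) : singleTensorHomologyMap L n (f + g) =
    singleTensorHomologyMap L n f + singleTensorHomologyMap L n g := by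
  simp only [singleTensorHomologyMap, ModuleCat.ofHom_add, Functor.map_add, add_whiskerRight',
    homologyMap_add, ModuleCat.hom_add]

lemma singleTensorHomologyMap_smul (r : R) (f : M →ₗ[R] N) : singleTensorHomologyMap L n (r • f) =
    r • singleTensorHomologyMap L n f := by
  have : (single (ModuleCat.{u} R) (ComplexShape.down ℕ) 0).map (ModuleCat.ofHom (r • f)) =
      r • (single _ _ 0).map (ModuleCat.ofHom f) := by
    apply from_single_hom_ext
    simp
    rfl
  simp only [singleTensorHomologyMap, this, smul_whiskerRight', homologyMap_smul,
    ModuleCat.hom_smul]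

lemma singleTensorHomologyMap_sum {ι : Type*} (s : Finset ι) (f : ι → M →ₗ[R] N) :
    singleTensorHomologyMap L n (∑ i ∈ s, f i) = ∑ i ∈ s, singleTensorHomologyMap L n (f i) :=
  map_sum (AddMonoidHom.mk' (fun f : M →ₗ[R] N => singleTensorHomologyMap L n f)
    (singleTensorHomologyMap_add L n)) f s

end

section

variable (L : ChainComplex (ModuleCat.{u} R) ℕ) (n : ℕ) {ι : Type*} [Fintype ι] [DecidableEq ι]
  {F : Type u} [AddCommGroup F] [Module R F] (b : Module.Basis ι R F)

/-- A basis of `F` identifies the homology of `F ⊗ L` with a power of that of `L`. -/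
def singleTensorHomologyEquivPi :
    (singleDeg R F 0 ⊗ L).homology n ≃ₗ[R] (ι → (singleDeg R R 0 ⊗ L).homology n) :=
  LinearEquiv.ofLinearMap
    (LinearMap.pi fun i => singleTensorHomologyMap L n (b.coord i))
    (∑ i, singleTensorHomologyMap L n (LinearMap.toSpanSingleton R F (b i)) ∘ₗ LinearMap.proj i)
    (by
      refine LinearMap.ext fun v => funext fun i => ?_
      have h (j : ι) : b.coord i ∘ₗ LinearMap.toSpanSingleton R F (b j) =
          (if i = j then (1 : R) else 0) • LinearMap.id := by
        ext
        split_ifs <;> simp_all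
      simp only [LinearMap.comp_apply, LinearMap.pi_apply, LinearMap.sum_apply, map_sum]
      have h' (j : ι) (x) : singleTensorHomologyMap L n (b.coord i) (singleTensorHomologyMap L n
          (LinearMap.toSpanSingleton R F (b j)) x) = (if i = j then (1 : R) else 0) • x := by
        rw [← LinearMap.comp_apply, ← singleTensorHomologyMap_comp, h,
          singleTensorHomologyMap_smul, singleTensorHomologyMap_id]
        rfl
      simp [h'])
    (by
      have h : LinearMap.id = ∑ i, LinearMap.toSpanSingleton R F (b i) ∘ₗ b.coord i := by
        refine LinearMap.ext fun v => ?_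
        simp [b.sum_repr]
      rw [← singleTensorHomologyMap_id, h, singleTensorHomologyMap_sum]
      refine LinearMap.ext fun v => ?_
      simp [singleTensorHomologyMap_comp])

lemma singleTensorHomologyEquivPi_map (φ : F →ₗ[R] F) (v) :
    singleTensorHomologyEquivPi L n b (singleTensorHomologyMap L n φ v) =
      matAct _ (LinearMap.toMatrix b b φ) (singleTensorHomologyEquivPi L n b v) := by
  funext i
  have h : b.coord i ∘ₗ φ = ∑ j, LinearMap.toMatrix b b φ i j • b.coord j := by
    refine b.ext fun k => ?_
    simp [LinearMap.toMatrix_apply, Finsupp.single_apply]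
  change singleTensorHomologyMap L n (b.coord i) (singleTensorHomologyMap L n φ v) = _
  rw [← LinearMap.comp_apply, ← singleTensorHomologyMap_comp, h, singleTensorHomologyMap_sum,
    matAct.apply]
  simp only [singleTensorHomologyMap_smul, LinearMap.sum_apply, LinearMap.smul_apply]
  rfl

/-- The homology of `R ⊗ L` is that of `L`. -/
def unitTensorHomologyEquiv : (singleDeg R R 0 ⊗ L).homology n ≃ₗ[R] L.homology n :=
  ((homologyFunctor _ _ n).mapIso (λ_ L)).toLinearEquiv

/-- This is the long exact sequence of F ⊗ L → K(φ) ⊗ L → F[1] ⊗ L, with connecting map A. -/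
theorem endoComplex.exists_exact_homology (φ : F →ₗ[R] F) :
    ∃ (f : ∀ n, (ι → L.homology n) →ₗ[R] (endoComplex φ ⊗ L).homology n)
      (g : ∀ n, (endoComplex φ ⊗ L).homology (n + 1) →ₗ[R] (ι → L.homology n)),
      Function.Surjective (f 0) ∧
      ∀ n, LinearMap.ker (f n) = LinearMap.range (matAct _ (LinearMap.toMatrix b b φ)) ∧
        LinearMap.range (f (n + 1)) = LinearMap.ker (g n) ∧
        LinearMap.range (g n) = LinearMap.ker (matAct _ (LinearMap.toMatrix b b φ)) := by
  let e (n : ℕ) : (singleDeg R F 0 ⊗ L).homology n ≃ₗ[R] (ι → L.homology n) :=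
    (singleTensorHomologyEquivPi L n b).trans
      (LinearEquiv.piCongrRight fun _ => unitTensorHomologyEquiv L n)
  have he (n v) : e n (singleTensorHomologyMap L n φ v) =
      matAct _ (LinearMap.toMatrix b b φ) (e n v) := by
    change (unitTensorHomologyEquiv L n).toLinearMap ∘ singleTensorHomologyEquivPi L n b _ =
      matAct _ _ ((unitTensorHomologyEquiv L n).toLinearMap ∘ singleTensorHomologyEquivPi L n b _)
    rw [matAct.map_comp, singleTensorHomologyEquivPi_map]
  have hS := tensorSeq_shortExact φ L
  have hI := tensorSeq_shortExact (LinearMap.id : F →ₗ[R] F) L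
  -- For φ = id the middle complex is contractible, so the connecting map is an isomorphism. By
  -- naturality along `tensorSeqHom` the connecting map of φ is this isomorphism followed by φ; it
  -- never has to be computed, and no sign or shift isomorphism enters.
  let δ (n : ℕ) := hI.δIso (n + 1) n rfl (isZero_homology_id L _) (isZero_homology_id L _)
  let d (n : ℕ) := (δ n).toLinearEquiv
  have hδ (n : ℕ) : hS.δ (n + 1) n rfl = (δ n).hom ≫
      ModuleCat.ofHom (singleTensorHomologyMap L n φ) := by
    have := HomologySequence.δ_naturality (tensorSeqHom φ L) hI hS (n + 1) n rfl
    change _ = homologyMap (𝟙 _) _ ≫ _ at this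
    rw [homologyMap_id, Category.id_comp] at this
    exact this.symm
  have hδ' (n x) : hS.δ (n + 1) n rfl x = singleTensorHomologyMap L n φ (d n x) := by
    rw [hδ]; rfl
  -- Nothing lies below degree 0, so an epimorphism of complexes is epi on H_0; here its source has
  -- zero homology. This yields surjectivity of `f 0`.
  have h₀ : Limits.IsZero ((singleDeg R F 1 ⊗ L).homology 0) := by
    have : Epi (tensorSeq (LinearMap.id : F →ₗ[R] F) L).g := hI.epi_g
    have := epi_homologyMap_of_epi_of_not_rel (tensorSeq (LinearMap.id : F →ₗ[R] F) L).g 0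
      (by simp)
    exact Limits.IsZero.of_epi (homologyMap (tensorSeq (LinearMap.id : F →ₗ[R] F) L).g 0)
      (isZero_homology_id L 0)
  let f (n : ℕ) := (homologyMap (incl φ ▷ L) n).hom
  let g (n : ℕ) := (homologyMap (proj φ ▷ L) n).hom
  have h₁ (n : ℕ) : Function.Exact (hS.δ (n + 1) n rfl).hom (f n) :=
    (ShortComplex.ShortExact.moduleCat_exact_iff_function_exact _).1
      (hS.homology_exact₁ (n + 1) n rfl)
  have h₂ (n : ℕ) : Function.Exact (f n) (g n) :=
    (ShortComplex.ShortExact.moduleCat_exact_iff_function_exact _).1 (hS.homology_exact₂ n)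
  have h₃ (n : ℕ) : Function.Exact (g (n + 1)) (hS.δ (n + 1) n rfl).hom :=
    (ShortComplex.ShortExact.moduleCat_exact_iff_function_exact _).1
      (hS.homology_exact₃ (n + 1) n rfl)
  refine ⟨fun n => f n ∘ₗ (e n).symm, fun n => (e n ∘ₗ (d n).toLinearMap) ∘ₗ g (n + 1), ?_,
    fun n => ⟨?_, ?_, ?_⟩⟩
  · intro x
    have := ModuleCat.subsingleton_of_isZero h₀
    obtain ⟨y, rfl⟩ := (h₂ 0 x).1 (Subsingleton.elim _ _)
    exact ⟨e 0 y, by simp⟩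
  · ext x
    obtain ⟨x, rfl⟩ := (e n).surjective x
    simp only [LinearMap.mem_ker, LinearMap.comp_apply, LinearEquiv.coe_coe,
      LinearEquiv.symm_apply_apply]
    rw [h₁ n x]
    constructor
    · rintro ⟨y, rfl⟩
      exact ⟨e n (d n y), by rw [← he, ← hδ']⟩
    · rintro ⟨y, hy⟩
      obtain ⟨y, rfl⟩ := (e n).surjective y
      obtain ⟨y, rfl⟩ := (d n).surjective y
      rw [← he, ← hδ'] at hy
      exact ⟨y, (e n).injective hy⟩
  · rw [LinearMap.range_comp_of_range_eq_top _ (LinearEquiv.range _),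
      LinearMap.ker_comp_of_ker_eq_bot, (h₂ (n + 1)).linearMap_ker_eq]
    exact LinearMap.ker_eq_bot.2 ((e n).injective.comp (d n).injective)
  · ext x
    obtain ⟨x, rfl⟩ := (e n).surjective x
    obtain ⟨x, rfl⟩ := (d n).surjective x
    rw [LinearMap.mem_ker, ← he, ← hδ', LinearEquiv.map_eq_zero_iff, h₃ n x]
    constructor
    · rintro ⟨y, hy⟩
      exact ⟨y, (d n).injective ((e n).injective hy)⟩
    · rintro ⟨y, rfl⟩
      exact ⟨y, rfl⟩

end
end

/-! ### Finite length, and the index of an endomorphism. -/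

noncomputable section

section FiniteLength

variable {R : Type*} [CommRing R]

lemma IsFiniteLength.of_exact {M₁ M₂ M₃ : Type*} [AddCommGroup M₁] [Module R M₁]
    [AddCommGroup M₂] [Module R M₂] [AddCommGroup M₃] [Module R M₃] {f : M₁ →ₗ[R] M₂}
    {g : M₂ →ₗ[R] M₃} (hf : Function.Injective f) (hg : Function.Surjective g)
    (h : Function.Exact f g) (h₁ : IsFiniteLength R M₁) (h₃ : IsFiniteLength R M₃) :
    IsFiniteLength R M₂ := by
  rw [← Module.length_ne_top_iff] at *
  rw [Module.length_eq_add_of_exact f g hf hg h]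
  exact WithTop.add_ne_top.2 ⟨h₁, h₃⟩

/-- The maximal ideal kills each simple quotient of a composition series, so one power of y is spent
per step. -/
lemma IsFiniteLength.exists_pow_mem_annihilator [IsLocalRing R] {M : Type*} [AddCommGroup M]
    [Module R M] (h : IsFiniteLength R M) {y : R} (hy : y ∈ IsLocalRing.maximalIdeal R) :
    ∃ k : ℕ, y ^ k ∈ Module.annihilator R M := by
  induction h with
  | of_subsingleton => exact ⟨0, Module.mem_annihilator.2 fun m => Subsingleton.elim _ _⟩
  | @of_simple_quotient M _ _ N hN _ ih =>
    obtain ⟨k, hk⟩ := ih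
    refine ⟨k + 1, Module.mem_annihilator.2 fun m => ?_⟩
    have h₁ : y • (N.mkQ m) = 0 := by
      have := IsSimpleModule.annihilator_isMaximal (R := R) (M := M ⧸ N)
      rw [IsLocalRing.eq_maximalIdeal this |>.symm] at hy
      exact Module.mem_annihilator.1 hy _
    rw [← map_smul, Submodule.mkQ_apply, Submodule.Quotient.mk_eq_zero] at h₁
    have := congrArg N.subtype (Module.mem_annihilator.1 hk ⟨_, h₁⟩)
    simpa [pow_succ, mul_smul] using this

/-- Finite length means support in the closed point. One direction is nilpotence of the maximal
ideal's elements on M; the other is dévissage to R/p, where p must be maximal and R/p simple. -/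
theorem isFiniteLength_iff_forall_prime [IsLocalRing R] [IsNoetherianRing R] {M : Type*}
    [AddCommGroup M] [Module R M] [Module.Finite R M] :
    IsFiniteLength R M ↔ ∀ p : Ideal R, p.IsPrime → Module.annihilator R M ≤ p →
      p = IsLocalRing.maximalIdeal R := by
  constructor
  · intro h p hp hle
    refine (IsLocalRing.le_maximalIdeal hp.ne_top).antisymm fun y hy => ?_
    obtain ⟨k, hk⟩ := h.exists_pow_mem_annihilator hy
    exact hp.mem_of_pow_mem k (hle hk)
  · refine IsNoetherianRing.induction_on_isQuotientEquivQuotientPrime R ‹_›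
      (motive := fun N _ _ _ => (∀ p : Ideal R, p.IsPrime → Module.annihilator R N ≤ p →
        p = IsLocalRing.maximalIdeal R) → IsFiniteLength R N) ?_ ?_ ?_
    · intro N _ _ _ _ _
      exact .of_subsingleton
    · intro N _ _ _ p e h
      have := h p.1 p.2 (by rw [e.annihilator_eq, Ideal.annihilator_quotient])
      refine (LinearEquiv.isFiniteLength e.symm) ?_
      have : p.1.IsMaximal := this ▸ inferInstance
      have : IsSimpleModule R (R ⧸ p.1) := (isSimpleModule_iff_isCoatom).2 this.out
      rw [isFiniteLength_iff_isNoetherian_isArtinian]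
      exact ⟨inferInstance, inferInstance⟩
    · intro N₁ _ _ _ N₂ _ _ _ N₃ _ _ _ f g hf hg hfg h₁ h₃ h
      exact .of_exact hf hg hfg
        (h₁ fun p hp hle => h p hp ((f.annihilator_le_of_injective hf).trans hle))
        (h₃ fun p hp hle => h p hp ((g.annihilator_le_of_surjective hg).trans hle))

lemma isFiniteLength_quotient_iff [IsLocalRing R] [IsNoetherianRing R] (I : Ideal R) :
    IsFiniteLength R (R ⧸ I) ↔ ∀ p : Ideal R, p.IsPrime → I ≤ p →
      p = IsLocalRing.maximalIdeal R := by
  rw [isFiniteLength_iff_forall_prime, Ideal.annihilator_quotient]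

end FiniteLength

section Index

variable {R : Type*} [CommRing R]

/-- The length of the cokernel minus the length of the kernel, meaningful when both are finite. -/
def LinearMap.lengthIndex {M : Type*} [AddCommGroup M] [Module R M] (f : M →ₗ[R] M) : ℤ :=
  ((Module.length R (M ⧸ LinearMap.range f)).toNat : ℤ) -
    (Module.length R (LinearMap.ker f)).toNat

variable {M N P : Type*} [AddCommGroup M] [Module R M] [AddCommGroup N] [Module R N]
  [AddCommGroup P] [Module R P]

lemma length_toNat_eq_add_of_exact {f : M →ₗ[R] N} {g : N →ₗ[R] P} (h : Function.Exact f g)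
    (hN : IsFiniteLength R N) : (Module.length R N).toNat =
      (Module.length R (LinearMap.range f)).toNat + (Module.length R (LinearMap.range g)).toNat := by
  have h₁ : IsFiniteLength R (LinearMap.range f) := hN.of_injective (Submodule.subtype_injective _)
  have h₂ : IsFiniteLength R (LinearMap.range g) := hN.of_surjective g.surjective_rangeRestrict
  rw [Module.length_eq_add_of_exact (LinearMap.range f).subtype g.rangeRestrict
    (Submodule.subtype_injective _) g.surjective_rangeRestrict ?_, ENat.toNat_add]
  · exact Module.length_ne_top_iff.2 h₁
  · exact Module.length_ne_top_iff.2 h₂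
  · rw [LinearMap.exact_iff, LinearMap.ker_rangeRestrict, Submodule.range_subtype]
    exact h.linearMap_ker_eq

lemma length_range_of_injective {f : M →ₗ[R] N} (hf : Function.Injective f) :
    Module.length R (LinearMap.range f) = Module.length R M :=
  (LinearEquiv.ofInjective f hf).length_eq.symm

lemma length_range_of_surjective {f : M →ₗ[R] N} (hf : Function.Surjective f) :
    Module.length R (LinearMap.range f) = Module.length R N := by
  rw [LinearMap.range_eq_top.2 hf, Module.length_top]

/-- Kernel and cokernel both have length λ(M) − λ(range f). -/
lemma LinearMap.lengthIndex_of_isFiniteLength {f : M →ₗ[R] M} (h : IsFiniteLength R M) :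
    f.lengthIndex = 0 := by
  have h₁ := length_toNat_eq_add_of_exact (f := (LinearMap.ker f).subtype) (g := f)
    (by rw [LinearMap.exact_iff, Submodule.range_subtype]) h
  have h₂ := length_toNat_eq_add_of_exact (f := f) (g := (LinearMap.range f).mkQ)
    (LinearMap.exact_map_mkQ_range f) h
  rw [length_range_of_injective (Submodule.subtype_injective _)] at h₁
  rw [length_range_of_surjective (Submodule.mkQ_surjective _)] at h₂
  rw [LinearMap.lengthIndex]
  lia

/-- Alternating sum of lengths in the six-term snake sequence. Finiteness is needed only at its four
inner terms: ker f embeds in ker g, and coker h is a quotient of coker g. -/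
theorem LinearMap.lengthIndex_of_exact {i : M →ₗ[R] N} {p : N →ₗ[R] P}
    (hi : Function.Injective i) (hp : Function.Surjective p) (hip : Function.Exact i p)
    {f : M →ₗ[R] M} {g : N →ₗ[R] N} {h : P →ₗ[R] P} (hfg : i ∘ₗ f = g ∘ₗ i) (hgh : p ∘ₗ g = h ∘ₗ p)
    (hfc : IsFiniteLength R (M ⧸ LinearMap.range f))
    (hgk : IsFiniteLength R (LinearMap.ker g)) (hgc : IsFiniteLength R (N ⧸ LinearMap.range g))
    (hhk : IsFiniteLength R (LinearMap.ker h)) :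
    g.lengthIndex = f.lengthIndex + h.lengthIndex := by
  have hik : ∀ x ∈ LinearMap.ker f, i x ∈ LinearMap.ker g := fun x hx => by
    rw [LinearMap.mem_ker, ← LinearMap.comp_apply, ← hfg, LinearMap.comp_apply,
      LinearMap.mem_ker.1 hx, map_zero]
  have hpk : ∀ x ∈ LinearMap.ker g, p x ∈ LinearMap.ker h := fun x hx => by
    rw [LinearMap.mem_ker, ← LinearMap.comp_apply, ← hgh, LinearMap.comp_apply,
      LinearMap.mem_ker.1 hx, map_zero]
  have hir : LinearMap.range f ≤ (LinearMap.range g).comap i := by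
    rintro _ ⟨x, rfl⟩
    exact ⟨i x, (LinearMap.congr_fun hfg x).symm⟩
  have hpr : LinearMap.range g ≤ (LinearMap.range h).comap p := by
    rintro _ ⟨x, rfl⟩
    exact ⟨p x, (LinearMap.congr_fun hgh x).symm⟩
  let i₁ := i.restrict hik
  let p₁ := p.restrict hpk
  let i₂ := Submodule.mapQ _ _ i hir
  let p₂ := Submodule.mapQ _ _ p hpr
  let δ := SnakeLemma.δ' f g h i p hip i p hip hfg hgh (LinearMap.ker h).subtype
    (by rw [LinearMap.exact_iff, Submodule.range_subtype]) (LinearMap.range f).mkQ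
    (LinearMap.exact_map_mkQ_range f) hp hi
  have e₁ : Function.Exact i₁ p₁ := by
    rintro ⟨x, hx⟩
    constructor
    · intro hx'
      obtain ⟨y, rfl⟩ := (hip x).1 (congrArg Subtype.val hx')
      refine ⟨⟨y, ?_⟩, rfl⟩
      rw [LinearMap.mem_ker, ← LinearMap.comp_apply, ← hfg, LinearMap.comp_apply] at hx
      exact hi (by rw [hx, map_zero])
    · rintro ⟨y, hy⟩
      rw [← hy]
      exact Subtype.ext (hip.apply_apply_eq_zero _)
  have e₂ : Function.Exact p₁ δ := SnakeLemma.exact_δ'_right f g h i p hip i p hip hfg hgh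
    (LinearMap.ker g).subtype (by rw [LinearMap.exact_iff, Submodule.range_subtype])
    (LinearMap.ker h).subtype (by rw [LinearMap.exact_iff, Submodule.range_subtype])
    (LinearMap.range f).mkQ (LinearMap.exact_map_mkQ_range f) hp hi p₁ rfl
    (Submodule.subtype_injective _)
  have e₃ : Function.Exact δ i₂ := SnakeLemma.exact_δ'_left f g h i p hip i p hip hfg hgh
    (LinearMap.ker h).subtype (by rw [LinearMap.exact_iff, Submodule.range_subtype])
    (LinearMap.range f).mkQ (LinearMap.exact_map_mkQ_range f)
    (LinearMap.range g).mkQ (LinearMap.exact_map_mkQ_range g) hp hi i₂ rfl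
    (Submodule.mkQ_surjective _)
  have e₄ : Function.Exact i₂ p₂ := by
    intro x
    obtain ⟨x, rfl⟩ := Submodule.mkQ_surjective _ x
    constructor
    · intro hx
      obtain ⟨y, hy⟩ := (Submodule.Quotient.mk_eq_zero _).1 hx
      obtain ⟨y, rfl⟩ := hp y
      rw [← LinearMap.comp_apply, ← hgh, LinearMap.comp_apply] at hy
      obtain ⟨z, hz⟩ := (hip (x - g y)).1 (by rw [map_sub, hy, sub_self])
      refine ⟨(LinearMap.range f).mkQ z, ?_⟩
      change (LinearMap.range g).mkQ (i z) = _
      rw [hz, map_sub, sub_eq_self]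
      exact (Submodule.Quotient.mk_eq_zero _).2 ⟨y, rfl⟩
    · rintro ⟨y, hy⟩
      obtain ⟨y, rfl⟩ := Submodule.mkQ_surjective _ y
      rw [← hy]
      change (LinearMap.range h).mkQ (p (i y)) = 0
      rw [hip.apply_apply_eq_zero, map_zero]
  have hi₁ : Function.Injective i₁ := fun x y hxy => Subtype.ext (hi (congrArg Subtype.val hxy))
  have hp₂ : Function.Surjective p₂ := fun x => by
    obtain ⟨x, rfl⟩ := Submodule.mkQ_surjective _ x
    obtain ⟨x, rfl⟩ := hp x
    exact ⟨(LinearMap.range g).mkQ x, rfl⟩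
  have l₁ := length_toNat_eq_add_of_exact e₁ hgk
  have l₂ := length_toNat_eq_add_of_exact e₂ hhk
  have l₃ := length_toNat_eq_add_of_exact e₃ hfc
  have l₄ := length_toNat_eq_add_of_exact e₄ hgc
  rw [length_range_of_injective hi₁] at l₁
  rw [length_range_of_surjective hp₂] at l₄
  simp only [LinearMap.lengthIndex]
  lia

end Index
end

/-! ### Additive functions on matrices over a domain. -/

noncomputable section

section Domain

open Matrix

/-- Conjugating by a diagonal matrix multiplies the transvection parameter by a, which clears its
denominator. -/
lemma Matrix.transvection_mul_diagonal_update {K : Type*} [CommRing K] {n : Type*} [Fintype n]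
    [DecidableEq n] {i j : n} (hij : i ≠ j) (c a : K) :
    transvection i j c * diagonal (Function.update 1 j a) =
      diagonal (Function.update 1 j a) * transvection i j (c * a) := by
  have h₁ : single i j c * diagonal (Function.update 1 j a) = single i j (c * a) := by
    ext k l
    rw [mul_diagonal, single_apply, single_apply]
    split_ifs with h
    · rw [← h.2, Function.update_self]
    · rw [zero_mul]
  have h₂ : diagonal (Function.update 1 j a) * single i j (c * a) = single i j (c * a) := by
    ext k l
    rw [diagonal_mul, single_apply]
    split_ifs with h
    · rw [← h.1, Function.update_of_ne hij, Pi.one_apply, one_mul]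
    · rw [mul_zero]
  rw [transvection, transvection, add_mul, mul_add, h₁, h₂, one_mul, mul_one]

variable {D : Type*} [CommRing D] [IsDomain D] {n : Type*} [Fintype n] [DecidableEq n]

/-- Over the fraction field, invertible matrices are products of diagonal matrices and
transvections. Additivity together with vanishing on scalars makes h insensitive to denominators, so
it passes to matrices over that field. -/
theorem Matrix.eq_zero_of_additive_of_det_ne_zero (h : Matrix n n D → ℤ)
    (hmul : ∀ A B : Matrix n n D, A.det ≠ 0 → B.det ≠ 0 → h (A * B) = h A + h B)
    (hdiag : ∀ d : n → D, (diagonal d).det ≠ 0 → h (diagonal d) = 0)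
    (htrans : ∀ t : TransvectionStruct n D, h t.toMatrix = 0)
    (A : Matrix n n D) (hA : A.det ≠ 0) : h A = 0 := by
  let K := FractionRing D
  let ι := algebraMap D K
  have hι : Function.Injective ι := IsFractionRing.injective D K
  have hdet (A : Matrix n n D) : (A.map ι).det = ι A.det := (RingHom.map_det ι A).symm
  have hdet₀ (A : Matrix n n D) : (A.map ι).det ≠ 0 ↔ A.det ≠ 0 := by
    rw [hdet, map_ne_zero_iff ι hι]
  have hsc (r : D) (A : Matrix n n D) : r • A = diagonal (fun _ => r) * A := by
    rw [← smul_eq_diagonal_mul]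
  have hsmul (r : D) (hr : r ≠ 0) (A : Matrix n n D) (hA : A.det ≠ 0) : h (r • A) = h A := by
    have : (diagonal fun _ : n => r).det ≠ 0 := by
      rw [det_diagonal]
      exact Finset.prod_ne_zero_iff.2 fun _ _ => hr
    rw [hsc, hmul _ _ this hA, hdiag _ this, zero_add]
  -- Quantifying over every integral multiple of g avoids choosing a denominator in the induction.
  suffices H : ∀ g : Matrix n n K, g.det ≠ 0 → ∀ (A : Matrix n n D) (b : D), b ≠ 0 →
      A.map ι = ι b • g → h A = 0 by
    exact H (A.map ι) ((hdet₀ A).2 hA) A 1 one_ne_zero (by simp)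
  have hne (g : Matrix n n K) (hg : g.det ≠ 0) (A : Matrix n n D) (b : D) (hb : b ≠ 0)
      (hAg : A.map ι = ι b • g) : A.det ≠ 0 := by
    rw [← hdet₀, hAg, det_smul]
    exact mul_ne_zero (pow_ne_zero _ ((map_ne_zero_iff ι hι).2 hb)) hg
  have hmap (A B : Matrix n n D) (hAB : A.map ι = B.map ι) : A = B := by
    ext i j
    exact hι (congrFun (congrFun hAB i) j)
  have hmapsmul (r : D) (A : Matrix n n D) : (r • A).map ι = ι r • A.map ι := by
    ext i j
    simp
  have hint (g : Matrix n n K) : ∃ (A : Matrix n n D) (b : D), b ≠ 0 ∧ A.map ι = ι b • g := by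
    obtain ⟨b, hb⟩ := IsLocalization.exist_integer_multiples_of_finite (nonZeroDivisors D)
      (fun ij : n × n => g ij.1 ij.2)
    choose a ha using hb
    refine ⟨Matrix.of fun i j => a (i, j), b, nonZeroDivisors.ne_zero b.2, ?_⟩
    ext i j
    simp only [map_apply, of_apply, smul_apply, smul_eq_mul]
    rw [show ι (a (i, j)) = _ from ha (i, j), Algebra.smul_def]
  intro g hg
  refine diagonal_transvection_induction_of_det_ne_zero (fun g => ∀ (A : Matrix n n D) (b : D),
    b ≠ 0 → A.map ι = ι b • g → h A = 0) g hg ?_ ?_ ?_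
  · intro d hd A b hb hA
    have hdA := hne _ hd A b hb hA
    have : A = diagonal fun i => A i i := by
      ext i j
      rcases eq_or_ne i j with rfl | hij
      · simp
      · have := congrFun (congrFun hA i) j
        simp only [map_apply, smul_apply, diagonal_apply_ne _ hij, smul_zero] at this
        rw [diagonal_apply_ne _ hij]
        exact hι (this.trans (map_zero ι).symm)
    rw [this] at hdA ⊢
    exact hdiag _ hdA
  · intro t A b hb hA
    have hdA := hne _ (by simp) A b hb hA
    obtain ⟨i, j, hij, c⟩ := t
    obtain ⟨c, a, rfl⟩ := IsLocalization.exists_mk'_eq (nonZeroDivisors D) c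
    have ha : (a : D) ≠ 0 := nonZeroDivisors.ne_zero a.2
    let E : Matrix n n D := diagonal (Function.update 1 j (a : D))
    have hE : E.det ≠ 0 := by
      rw [det_diagonal]
      refine Finset.prod_ne_zero_iff.2 fun k _ => ?_
      rcases eq_or_ne k j with rfl | hk
      · rwa [Function.update_self]
      · simp [Function.update_of_ne hk]
    let T : TransvectionStruct n D := ⟨i, j, hij, c⟩
    -- Here A is b times the transvection with parameter c/a, and E scales column j by a, so the
    -- transvection on the right has integral parameter c.
    have key : A * E = b • (E * T.toMatrix) := by
      apply hmap
      rw [Matrix.map_mul, hA, hmapsmul, Matrix.map_mul, smul_mul_assoc]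
      congr 1
      have hc : IsLocalization.mk' K c a * ι a = ι c := IsLocalization.mk'_spec K c a
      have hT : T.toMatrix.map ι = transvection i j (ι c) := by
        ext k l
        simp [T, TransvectionStruct.toMatrix, transvection, one_apply, single_apply, apply_ite ι]
      have hE' : E.map ι = diagonal (Function.update 1 j (ι a)) := by
        rw [diagonal_map (map_zero ι)]
        congr 1
        funext k
        rcases eq_or_ne k j with rfl | hk
        · simp
        · simp [Function.update_of_ne hk]
      rw [hT, hE', ← hc, ← transvection_mul_diagonal_update hij]
      rfl
    have h₁ := hmul A E hdA hE
    rw [key, hsmul b hb _ (by simpa using hE), hmul E _ hE (by simp), htrans] at h₁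
    lia
  · intro g₁ g₂ hg₁ hg₂ h₁ h₂ A b hb hA
    obtain ⟨A₁, b₁, hb₁, hA₁⟩ := hint g₁
    obtain ⟨A₂, b₂, hb₂, hA₂⟩ := hint g₂
    have hd := hne _ (by rw [det_mul]; exact mul_ne_zero hg₁ hg₂) A b hb hA
    have hd₁ := hne _ hg₁ _ _ hb₁ hA₁
    have hd₂ := hne _ hg₂ _ _ hb₂ hA₂
    have key : (b₁ * b₂) • A = b • (A₁ * A₂) := by
      apply hmap
      rw [hmapsmul, hmapsmul, hA, Matrix.map_mul, hA₁, hA₂, smul_mul_smul_comm, smul_smul,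
        smul_smul, map_mul]
      congr 1
      ring
    rw [← hsmul _ (mul_ne_zero hb₁ hb₂) A hd, key, hsmul b hb _ (by
      rw [det_mul]; exact mul_ne_zero hd₁ hd₂), hmul _ _ hd₁ hd₂, h₁ _ _ hb₁ hA₁, h₂ _ _ hb₂ hA₂,
      add_zero]

end Domain
end

/-! ### The adjugate, and lengths of cokernels over a domain of dimension at most 1. -/

noncomputable section

section Adjugate

variable {R : Type*} [CommRing R] {n : Type*} [Fintype n] [DecidableEq n]
  {N : Type*} [AddCommGroup N] [Module R N] (A : Matrix n n R)

lemma matAct.adjugate_apply (v : n → N) :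
    matAct N A.adjugate (matAct N A v) = A.det • v := by
  rw [← LinearMap.comp_apply, ← matAct.mul, Matrix.adjugate_mul, matAct.scalar]

lemma matAct.apply_adjugate (v : n → N) :
    matAct N A (matAct N A.adjugate v) = A.det • v := by
  rw [← LinearMap.comp_apply, ← matAct.mul, Matrix.mul_adjugate, matAct.scalar]

lemma matAct.injective (h : ∀ x : N, A.det • x = 0 → x = 0) :
    Function.Injective (matAct N A) := by
  refine (injective_iff_map_eq_zero _).2 fun v hv => ?_
  have := matAct.adjugate_apply A v
  rw [hv, map_zero] at this
  exact funext fun i => h _ (congrFun this.symm i)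

lemma matAct.surjective (h : IsUnit A.det) : Function.Surjective (matAct N A) := by
  obtain ⟨u, hu⟩ := h
  intro v
  refine ⟨matAct N A.adjugate ((u⁻¹ : Rˣ) • v), ?_⟩
  rw [matAct.apply_adjugate, ← hu]
  exact smul_inv_smul u v

lemma matAct.det_smul_mem_range (v : n → N) : A.det • v ∈ LinearMap.range (matAct N A) :=
  ⟨_, matAct.apply_adjugate A v⟩

lemma matAct.det_smul_eq_zero {v : n → N} (h : matAct N A v = 0) : A.det • v = 0 := by
  rw [← matAct.adjugate_apply, h, map_zero]

end Adjugate

section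

variable {R : Type*} [CommRing R] {M : Type*} [AddCommGroup M] [Module R M]

/-- Injectivity of f identifies M / range g with range f / range (f ∘ g). -/
lemma length_quotient_range_comp {f : M →ₗ[R] M} (hf : Function.Injective f) (g : M →ₗ[R] M) :
    Module.length R (M ⧸ LinearMap.range (f ∘ₗ g)) =
      Module.length R (M ⧸ LinearMap.range g) + Module.length R (M ⧸ LinearMap.range f) := by
  have h₁ : LinearMap.range g ≤ (LinearMap.range (f ∘ₗ g)).comap f := by
    rintro _ ⟨x, rfl⟩
    exact ⟨x, rfl⟩
  have h₂ : LinearMap.range (f ∘ₗ g) ≤ LinearMap.range f := LinearMap.range_comp_le_range g f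
  refine Module.length_eq_add_of_exact (Submodule.mapQ _ _ f h₁) (Submodule.factor h₂) ?_
    (Submodule.factor_surjective h₂) ?_
  · refine (injective_iff_map_eq_zero _).2 fun x hx => ?_
    obtain ⟨x, rfl⟩ := Submodule.mkQ_surjective _ x
    obtain ⟨y, hy⟩ := (Submodule.Quotient.mk_eq_zero _).1 hx
    exact (Submodule.Quotient.mk_eq_zero _).2 ⟨y, hf hy⟩
  · intro x
    obtain ⟨x, rfl⟩ := Submodule.mkQ_surjective _ x
    constructor
    · intro hx
      obtain ⟨y, rfl⟩ := (Submodule.Quotient.mk_eq_zero _).1 hx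
      exact ⟨Submodule.Quotient.mk y, rfl⟩
    · rintro ⟨y, hy⟩
      obtain ⟨y, rfl⟩ := Submodule.mkQ_surjective _ y
      rw [← hy]
      exact (Submodule.Quotient.mk_eq_zero _).2 ⟨y, rfl⟩

end

section Domain

open Matrix

variable {D : Type*} [CommRing D] {n : Type*} [Fintype n] [DecidableEq n]

lemma length_coker_matAct_mul [IsDomain D] {A : Matrix n n D} (hA : A.det ≠ 0) (B : Matrix n n D) :
    Module.length D ((n → D) ⧸ LinearMap.range (matAct D (A * B))) =
      Module.length D ((n → D) ⧸ LinearMap.range (matAct D B)) +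
        Module.length D ((n → D) ⧸ LinearMap.range (matAct D A)) := by
  rw [matAct.mul, length_quotient_range_comp]
  refine matAct.injective A fun x hx => ?_
  simpa [hA] using hx

lemma length_coker_matAct_diagonal (d : n → D) :
    Module.length D ((n → D) ⧸ LinearMap.range (matAct D (diagonal d))) =
      ∑ i, Ring.ord D (d i) := by
  have : LinearMap.range (matAct D (diagonal d)) =
      Submodule.pi Set.univ fun i => Ideal.span {d i} := by
    ext v
    simp only [LinearMap.mem_range, Submodule.mem_pi, Set.mem_univ, true_implies,
      Ideal.mem_span_singleton']
    constructor
    · rintro ⟨w, rfl⟩ i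
      exact ⟨w i, by rw [matAct.diagonal, smul_eq_mul, mul_comm]⟩
    · intro h
      choose w hw using h
      exact ⟨w, funext fun i => by rw [matAct.diagonal, smul_eq_mul, mul_comm, hw]⟩
  rw [this, (Submodule.quotientPi _).length_eq, Module.length_pi_of_fintype]
  rfl

lemma ord_prod [IsDomain D] {ι : Type*} (s : Finset ι) (d : ι → D) (hd : ∀ i, d i ≠ 0) :
    Ring.ord D (∏ i ∈ s, d i) = ∑ i ∈ s, Ring.ord D (d i) := by
  classical
  induction s using Finset.induction_on with
  | empty => simp
  | insert i s hi ih =>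
    rw [Finset.prod_insert hi, Finset.sum_insert hi, Ring.ord_mul', ih]
    exact mem_nonZeroDivisors_of_ne_zero (hd i)

theorem length_coker_matAct [IsDomain D] [IsNoetherianRing D] [Ring.KrullDimLE 1 D] {A : Matrix n n D}
    (hA : A.det ≠ 0) :
    Module.length D ((n → D) ⧸ LinearMap.range (matAct D A)) = Ring.ord D A.det := by
  let ℓ (A : Matrix n n D) := Module.length D ((n → D) ⧸ LinearMap.range (matAct D A))
  have hord (a : D) (ha : a ≠ 0) : Ring.ord D a ≠ ⊤ :=
    Ring.ord_ne_top (mem_nonZeroDivisors_of_ne_zero ha)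
  have hdiag (d : n → D) (hd : (diagonal d).det ≠ 0) :
      ℓ (diagonal d) = Ring.ord D (diagonal d).det := by
    rw [det_diagonal] at hd ⊢
    rw [ord_prod _ _ fun i => Finset.prod_ne_zero_iff.1 hd i (Finset.mem_univ i)]
    exact length_coker_matAct_diagonal d
  -- The cokernel of A is no longer than that of A · adj A = det A · 1, which is diagonal.
  -- Finiteness is what makes the `toNat` difference below additive.
  have hℓ (A : Matrix n n D) (hA : A.det ≠ 0) : ℓ A ≠ ⊤ := by
    have h₁ := length_coker_matAct_mul hA A.adjugate
    rw [mul_adjugate, smul_one_eq_diagonal] at h₁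
    have h₂ : (diagonal fun _ : n => A.det).det ≠ 0 := by
      rw [det_diagonal]
      exact Finset.prod_ne_zero_iff.2 fun _ _ => hA
    have h₃ := hdiag _ h₂
    intro h
    change ℓ _ = _ + ℓ A at h₁
    rw [h, add_top, h₃] at h₁
    exact hord _ h₂ h₁
  have key := eq_zero_of_additive_of_det_ne_zero
    (fun A : Matrix n n D => ((ℓ A).toNat : ℤ) - (Ring.ord D A.det).toNat) ?_ ?_ ?_ A hA
  · have : (ℓ A).toNat = (Ring.ord D A.det).toNat := by lia
    change ℓ A = _
    rw [← ENat.natCast_toNat (hℓ A hA), this, ENat.natCast_toNat (hord _ hA)]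
  · intro A B hA hB
    have h₁ : ℓ (A * B) = ℓ B + ℓ A := length_coker_matAct_mul hA B
    rw [h₁, det_mul, Ring.ord_mul' _ (mem_nonZeroDivisors_of_ne_zero hA),
      ENat.toNat_add (hℓ B hB) (hℓ A hA), ENat.toNat_add (hord _ hA) (hord _ hB)]
    lia
  · intro d hd
    rw [hdiag d hd, sub_self]
  · intro t
    have : ℓ t.toMatrix = 0 := by
      rw [Module.length_eq_zero_iff, Submodule.Quotient.subsingleton_iff, LinearMap.range_eq_top]
      exact matAct.surjective _ (by simp)
    rw [this, TransvectionStruct.det, Ring.ord_one]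
    simp

end Domain
end

/-! ### The index depends only on the determinant. -/

noncomputable section

section

variable {R : Type*} [CommRing R] [IsLocalRing R] [IsNoetherianRing R]
  {m n : Type*} [Fintype m] [DecidableEq m] [Fintype n] [DecidableEq n]
  {N : Type*} [AddCommGroup N] [Module R N] [Module.Finite R N]

lemma isFiniteLength_ker_matAct (A : Matrix n n R)
    (h : ∀ p : Ideal R, p.IsPrime → Module.annihilator R N ≤ p → A.det ∈ p →
      p = IsLocalRing.maximalIdeal R) :
    IsFiniteLength R (LinearMap.ker (matAct N A)) := by
  rw [isFiniteLength_iff_forall_prime]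
  refine fun p hp hle => h p hp (le_trans (fun r hr => ?_) hle) (hle ?_)
  · rw [Module.mem_annihilator] at hr ⊢
    exact fun v => Subtype.ext (funext fun i => hr _)
  · rw [Module.mem_annihilator]
    exact fun v => Subtype.ext (matAct.det_smul_eq_zero A v.2)

lemma isFiniteLength_coker_matAct (A : Matrix n n R)
    (h : ∀ p : Ideal R, p.IsPrime → Module.annihilator R N ≤ p → A.det ∈ p →
      p = IsLocalRing.maximalIdeal R) :
    IsFiniteLength R ((n → N) ⧸ LinearMap.range (matAct N A)) := by
  rw [isFiniteLength_iff_forall_prime]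
  refine fun p hp hle => h p hp (le_trans (fun r hr => ?_) hle) (hle ?_)
  · rw [Module.mem_annihilator] at hr ⊢
    intro v
    obtain ⟨v, rfl⟩ := Submodule.mkQ_surjective _ v
    rw [← map_smul, show r • v = 0 from funext fun i => hr _, map_zero]
  · rw [Module.mem_annihilator]
    intro v
    obtain ⟨v, rfl⟩ := Submodule.mkQ_surjective _ v
    rw [← map_smul]
    exact (Submodule.Quotient.mk_eq_zero _).2 (matAct.det_smul_mem_range A v)

/-- Modulo x the ring R/p has dimension at most 0, and dividing by one element of the Jacobson
radical lowers the dimension by at most 1. -/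
lemma krullDimLE_one_quotient {p : Ideal R} [p.IsPrime] {x : R}
    (hx : x ∈ IsLocalRing.maximalIdeal R)
    (h : ∀ q : Ideal R, q.IsPrime → p ≤ q → x ∈ q → q = IsLocalRing.maximalIdeal R) :
    Ring.KrullDimLE 1 (R ⧸ p) := by
  have hloc : IsLocalRing (R ⧸ p) := .of_surjective' _ Ideal.Quotient.mk_surjective
  have hx' : Ideal.Quotient.mk p x ∈ Ring.jacobson (R ⧸ p) := by
    rw [IsLocalRing.ringJacobson_eq_maximalIdeal, IsLocalRing.mem_maximalIdeal, mem_nonunits_iff]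
    intro hu
    obtain ⟨y, hy⟩ := hu.exists_right_inv
    obtain ⟨y, rfl⟩ := Ideal.Quotient.mk_surjective y
    rw [← map_mul, ← map_one (Ideal.Quotient.mk p), Ideal.Quotient.eq] at hy
    have h₁ := IsLocalRing.le_maximalIdeal (Ideal.IsPrime.ne_top ‹p.IsPrime›) hy
    exact (Ideal.ne_top_iff_one _).1 (IsLocalRing.maximalIdeal.isMaximal R).ne_top
      ((Submodule.sub_mem_iff_right _ (Ideal.mul_mem_right y _ hx)).1 h₁)
  have h₁ := ringKrullDim_le_ringKrullDim_quotient_add_encard {Ideal.Quotient.mk p x}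
    (Set.singleton_subset_iff.2 hx')
  have h₂ : Ring.KrullDimLE 0 ((R ⧸ p) ⧸ Ideal.span {Ideal.Quotient.mk p x}) := by
    rw [Ring.krullDimLE_zero_iff]
    intro q hq
    let f := (Ideal.Quotient.mk (Ideal.span {Ideal.Quotient.mk p x})).comp (Ideal.Quotient.mk p)
    have hf : Function.Surjective f :=
      Ideal.Quotient.mk_surjective.comp Ideal.Quotient.mk_surjective
    have hq' := h (q.comap f) inferInstance (fun r hr => by
      rw [Ideal.mem_comap, RingHom.comp_apply, Ideal.Quotient.eq_zero_iff_mem.2 hr, map_zero]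
      exact q.zero_mem) (by
      rw [Ideal.mem_comap, RingHom.comp_apply,
        Ideal.Quotient.eq_zero_iff_mem.2 (Ideal.mem_span_singleton_self _)]
      exact q.zero_mem)
    have : (q.comap f).IsMaximal := hq' ▸ inferInstance
    have := Ideal.map_eq_top_or_isMaximal_of_surjective f hf this
    rw [Ideal.map_comap_of_surjective f hf] at this
    exact this.resolve_left hq.ne_top
  rw [Ring.krullDimLE_iff] at h₂ ⊢
  refine h₁.trans ?_
  rw [Set.encard_singleton]
  exact (add_le_add_left h₂ _).trans (by norm_num)

omit [IsLocalRing R] [Module.Finite R N] in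
lemma length_coker_matAct_quotient_prime {p : Ideal R} [p.IsPrime]
    [Ring.KrullDimLE 1 (R ⧸ p)] (e : N ≃ₗ[R] R ⧸ p) (A : Matrix n n R) (hA : A.det ∉ p) :
    Module.length R ((n → N) ⧸ LinearMap.range (matAct N A)) =
      Ring.ord (R ⧸ p) (Ideal.Quotient.mk p A.det) := by
  let A' : Matrix n n (R ⧸ p) := A.map (Ideal.Quotient.mk p)
  have hdet : A'.det = Ideal.Quotient.mk p A.det := ((Ideal.Quotient.mk p).map_det A).symm
  have hA' : A'.det ≠ 0 := by
    rwa [hdet, Ne, Ideal.Quotient.eq_zero_iff_mem]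
  rw [← hdet, ← length_coker_matAct hA',
    ← Module.length_eq_of_surjective (S := R) (R := R ⧸ p) Ideal.Quotient.mk_surjective]
  let E : (n → N) ≃ₗ[R] (n → R ⧸ p) := LinearEquiv.piCongrRight fun _ => e
  have hE (v) : E (matAct N A v) = matAct (R ⧸ p) A' (E v) := by
    funext i
    rw [matAct.apply]
    change e (matAct N A v i) = ∑ j, A' i j • e (v j)
    rw [matAct.apply, map_sum]
    simp only [map_smul]
    rfl
  refine (Submodule.Quotient.equiv _ ((LinearMap.range (matAct (R ⧸ p) A')).restrictScalars R) E
    ?_).length_eq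
  ext v
  constructor
  · rintro ⟨_, ⟨w, rfl⟩, rfl⟩
    exact ⟨E w, (hE w).symm⟩
  · rintro ⟨w, rfl⟩
    obtain ⟨w, rfl⟩ := E.surjective w
    exact ⟨_, ⟨w, rfl⟩, hE w⟩

omit [IsLocalRing R] [IsNoetherianRing R] [DecidableEq n] [Module.Finite R N] in
lemma lengthIndex_matAct_of_injective {A : Matrix n n R} (h : Function.Injective (matAct N A)) :
    (matAct N A).lengthIndex =
      (Module.length R ((n → N) ⧸ LinearMap.range (matAct N A))).toNat := by
  rw [LinearMap.lengthIndex, LinearMap.ker_eq_bot.2 h, Module.length_bot]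
  simp

omit [IsLocalRing R] [IsNoetherianRing R] [Module.Finite R N] in
lemma lengthIndex_matAct_of_isUnit {A : Matrix n n R} (h : IsUnit A.det) :
    (matAct N A).lengthIndex = 0 := by
  rw [lengthIndex_matAct_of_injective (matAct.injective A fun x hx => (h.smul_eq_zero).1 hx),
    LinearMap.range_eq_top.2 (matAct.surjective A h),
    Module.length_eq_zero_iff.2 (Submodule.Quotient.subsingleton_iff.2 rfl)]
  simp

omit [DecidableEq n] in
lemma isFiniteLength_pi (h : ∀ p : Ideal R, p.IsPrime → Module.annihilator R N ≤ p →
    p = IsLocalRing.maximalIdeal R) : IsFiniteLength R (n → N) := by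
  rw [isFiniteLength_iff_forall_prime]
  refine fun q hq hle => h q hq (le_trans (fun r hr => ?_) hle)
  rw [Module.mem_annihilator] at hr ⊢
  exact fun v => funext fun i => hr _

lemma lengthIndex_matAct_of_exact {N₁ N₂ N₃ : Type*} [AddCommGroup N₁] [Module R N₁]
    [AddCommGroup N₂] [Module R N₂] [AddCommGroup N₃] [Module R N₃] [Module.Finite R N₁]
    [Module.Finite R N₂] [Module.Finite R N₃] {f : N₁ →ₗ[R] N₂} {g : N₂ →ₗ[R] N₃}
    (hf : Function.Injective f) (hg : Function.Surjective g) (hfg : Function.Exact f g)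
    (C : Matrix n n R) (h : ∀ p : Ideal R, p.IsPrime → Module.annihilator R N₂ ≤ p → C.det ∈ p →
      p = IsLocalRing.maximalIdeal R) :
    (matAct N₂ C).lengthIndex = (matAct N₁ C).lengthIndex + (matAct N₃ C).lengthIndex := by
  refine LinearMap.lengthIndex_of_exact (i := f.compLeft n) (p := g.compLeft n)
    hf.comp_left hg.comp_left ?_ ?_ ?_
    (isFiniteLength_coker_matAct C fun p hp hle =>
      h p hp ((f.annihilator_le_of_injective hf).trans hle))
    (isFiniteLength_ker_matAct C h) (isFiniteLength_coker_matAct C h)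
    (isFiniteLength_ker_matAct C fun p hp hle =>
      h p hp ((g.annihilator_le_of_surjective hg).trans hle))
  · intro v
    constructor
    · intro hv
      choose w hw using fun i => (hfg (v i)).1 (congrFun hv i)
      exact ⟨w, funext hw⟩
    · rintro ⟨w, rfl⟩
      exact funext fun i => hfg.apply_apply_eq_zero _
  · exact LinearMap.ext fun v => (matAct.map_comp N₁ f C v).symm
  · exact LinearMap.ext fun v => (matAct.map_comp N₂ g C v).symm

/-- Dévissage in N. On R/p, either det A ∈ p and both indices vanish because N has finite length, or
det A is a unit and both maps are bijective, or both maps are injective with cokernel of length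
ord(det A). The two matrices may have different sizes, so B can be the 1 × 1 matrix det A. -/
theorem lengthIndex_matAct_eq (A : Matrix m m R) (B : Matrix n n R) (hAB : A.det = B.det)
    (h : ∀ p : Ideal R, p.IsPrime → Module.annihilator R N ≤ p → A.det ∈ p →
      p = IsLocalRing.maximalIdeal R) :
    (matAct N A).lengthIndex = (matAct N B).lengthIndex := by
  refine IsNoetherianRing.induction_on_isQuotientEquivQuotientPrime R ‹Module.Finite R N›
    (motive := fun N _ _ _ => (∀ p : Ideal R, p.IsPrime → Module.annihilator R N ≤ p → A.det ∈ p →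
      p = IsLocalRing.maximalIdeal R) → (matAct N A).lengthIndex = (matAct N B).lengthIndex)
      ?_ ?_ ?_ h
  · intro N _ _ _ _ _
    rw [LinearMap.lengthIndex_of_isFiniteLength .of_subsingleton,
      LinearMap.lengthIndex_of_isFiniteLength .of_subsingleton]
  · intro N _ _ _ p e h
    have hp := p.2
    rw [e.annihilator_eq, Ideal.annihilator_quotient] at h
    by_cases hx : A.det ∈ p.1
    · have hN : ∀ q : Ideal R, q.IsPrime → Module.annihilator R N ≤ q →
          q = IsLocalRing.maximalIdeal R := fun q hq hle => by
        rw [e.annihilator_eq, Ideal.annihilator_quotient] at hle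
        exact h q hq hle (hle hx)
      rw [LinearMap.lengthIndex_of_isFiniteLength (isFiniteLength_pi hN),
        LinearMap.lengthIndex_of_isFiniteLength (isFiniteLength_pi hN)]
    · by_cases hm : A.det ∈ IsLocalRing.maximalIdeal R
      · have := krullDimLE_one_quotient hm h
        have hinj (x : N) (hx' : A.det • x = 0) : x = 0 := by
          apply e.injective
          obtain ⟨r, hr⟩ := Ideal.Quotient.mk_surjective (e x)
          have h₁ := congrArg e hx'
          rw [map_smul, ← hr, map_zero, Algebra.smul_def] at h₁
          rw [map_zero, ← hr]
          exact (mul_eq_zero.1 h₁).resolve_left fun h₀ => hx (Ideal.Quotient.eq_zero_iff_mem.1 h₀)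
        rw [lengthIndex_matAct_of_injective (matAct.injective A hinj),
          lengthIndex_matAct_of_injective (matAct.injective B (hAB ▸ hinj)),
          length_coker_matAct_quotient_prime e A hx,
          length_coker_matAct_quotient_prime e B (hAB ▸ hx), hAB]
      · have hu : IsUnit A.det := by simpa using hm
        rw [lengthIndex_matAct_of_isUnit hu, lengthIndex_matAct_of_isUnit (hAB ▸ hu)]
  · intro N₁ _ _ _ N₂ _ _ _ N₃ _ _ _ f g hf hg hfg h₁ h₃ h
    rw [lengthIndex_matAct_of_exact hf hg hfg A h,
      lengthIndex_matAct_of_exact hf hg hfg B (hAB ▸ h),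
      h₁ fun p hp hle => h p hp ((f.annihilator_le_of_injective hf).trans hle),
      h₃ fun p hp hle => h p hp ((g.annihilator_le_of_surjective hg).trans hle)]

end
end

/-! ### The support of the cokernel of a matrix. -/

noncomputable section

section

variable {R : Type*} [CommRing R] {N : Type*} [AddCommGroup N] [Module R N] [Module.Finite R N]

/-- By Cayley–Hamilton, s is a root on N of a monic P whose lower coefficients lie in p. Then P(s)
kills N, so P(s) ∈ p, and a power of s is in p. -/
lemma mem_of_smul_mem_smul_top {p : Ideal R} [hp : p.IsPrime] (hN : Module.annihilator R N ≤ p)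
    {s : R} (hs : ∀ v : N, s • v ∈ p • (⊤ : Submodule R N)) : s ∈ p := by
  obtain ⟨P, hP, -, hcoeff, hroot⟩ :=
    LinearMap.exists_monic_and_natDegree_eq_and_coeff_mem_pow_and_aeval_eq_zero R
      (algebraMap R (Module.End R N) s) p (by
        rintro _ ⟨v, rfl⟩
        exact hs v)
  have h₁ : P.eval s ∈ p := by
    refine hN (Module.mem_annihilator.2 fun v => ?_)
    rw [Polynomial.aeval_algebraMap_apply] at hroot
    simpa using LinearMap.congr_fun hroot v
  rw [Polynomial.eval_eq_sum_range, Finset.sum_range_succ, hP.coeff_natDegree, one_mul] at h₁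
  refine hp.mem_of_pow_mem _ ((Submodule.add_mem_iff_right _ ?_).1 h₁)
  refine Ideal.sum_mem _ fun i hi => Ideal.mul_mem_right _ _ (Ideal.pow_le_self ?_ (hcoeff i))
  exact Nat.sub_ne_zero_of_lt (Finset.mem_range.1 hi)

/-- Modulo p the singular matrix A has a nonzero row vector w with wA = 0. If r kills the cokernel,
write r v e_i = A z; pairing with w gives w_i r v ∈ pN for all v, with w_i ∉ p. -/
theorem annihilator_coker_matAct_le {n : Type*} [Fintype n] [DecidableEq n] (A : Matrix n n R)
    {p : Ideal R} [hp : p.IsPrime] (hN : Module.annihilator R N ≤ p) (hA : A.det ∈ p) :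
    Module.annihilator R ((n → N) ⧸ LinearMap.range (matAct N A)) ≤ p := by
  intro r hr
  have hdet : (A.map (Ideal.Quotient.mk p)).det = 0 := by
    rw [← RingHom.mapMatrix_apply, ← RingHom.map_det, Ideal.Quotient.eq_zero_iff_mem]
    exact hA
  obtain ⟨u, hu, huA⟩ := Matrix.exists_vecMul_eq_zero_iff.2 hdet
  choose w hw using fun i => Ideal.Quotient.mk_surjective (u i)
  obtain ⟨i, hi⟩ := Function.ne_iff.1 hu
  have hwi : w i ∉ p := by
    rwa [← Ideal.Quotient.eq_zero_iff_mem, hw]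
  have hwA (j : n) : ∑ k, w k * A k j ∈ p := by
    rw [← Ideal.Quotient.eq_zero_iff_mem, map_sum]
    simpa [Matrix.vecMul, dotProduct, hw] using congrFun huA j
  refine (hp.mem_or_mem (mem_of_smul_mem_smul_top (s := w i * r) hN fun v => ?_)).resolve_left hwi
  have h₁ := Module.mem_annihilator.1 hr ((LinearMap.range (matAct N A)).mkQ (Pi.single i v))
  rw [← map_smul] at h₁
  obtain ⟨z, hz⟩ := (Submodule.Quotient.mk_eq_zero _).1 h₁
  have h₂ : (w i * r) • v = ∑ k, w k • matAct N A z k := by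
    rw [hz, Finset.sum_eq_single i]
    · simp [mul_smul]
    · intro k _ hk
      simp [Pi.single_eq_of_ne hk]
    · simp
  have h₃ : ∑ k, w k • matAct N A z k = ∑ j, (∑ k, w k * A k j) • z j := by
    simp only [matAct.apply, Finset.smul_sum, Finset.sum_smul, mul_smul]
    exact Finset.sum_comm
  rw [h₂, h₃]
  exact Submodule.sum_mem _ fun j _ => Submodule.smul_mem_smul (hwA j) trivial

end
end

/-! ### Cones on matrices: support, vanishing and Euler characteristic. -/

noncomputable section

section

variable {R : Type u} [CommRing R]

/-- For every complex `L`, the homology of `K ⊗ L` is an extension of the kernels by the cokernels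
of the actions of the matrix `A` on the homology of `L`, as for a cone on `A`. -/
def IsMatrixCone (K : ChainComplex (ModuleCat.{u} R) ℕ) {ι : Type*} [Fintype ι]
    (A : Matrix ι ι R) : Prop :=
  ∀ L : ChainComplex (ModuleCat.{u} R) ℕ,
    ∃ (f : ∀ n, (ι → L.homology n) →ₗ[R] (K ⊗ L).homology n)
      (g : ∀ n, (K ⊗ L).homology (n + 1) →ₗ[R] (ι → L.homology n)),
      Function.Surjective (f 0) ∧
      ∀ n, LinearMap.ker (f n) = LinearMap.range (matAct _ A) ∧
        LinearMap.range (f (n + 1)) = LinearMap.ker (g n) ∧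
        LinearMap.range (g n) = LinearMap.ker (matAct _ A)

/-- `K` behaves under tensor products as the cone on a matrix of determinant `x`. -/
def IsConeOfDet (K : ChainComplex (ModuleCat.{u} R) ℕ) (x : R) : Prop :=
  ∃ (n : ℕ) (A : Matrix (Fin n) (Fin n) R), A.det = x ∧ IsMatrixCone K A

lemma endoComplex.isConeOfDet [Nontrivial R] {F : Type u} [AddCommGroup F] [Module R F]
    [Module.Free R F] [Module.Finite R F] (φ : F →ₗ[R] F) :
    IsConeOfDet (endoComplex φ) (LinearMap.det φ) :=
  ⟨_, LinearMap.toMatrix (Module.finBasis R F) (Module.finBasis R F) φ, LinearMap.det_toMatrix _ _,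
    fun L => exists_exact_homology L (Module.finBasis R F) φ⟩

lemma endoComplex.isConeOfDet_mulLeft [Nontrivial R] (x : R) :
    IsConeOfDet (endoComplex (LinearMap.mulLeft R x)) x := by
  have := isConeOfDet (LinearMap.mulLeft R x)
  rwa [LinearMap.det_ring, LinearMap.mulLeft_apply, mul_one] at this

lemma endoComplex.exists_exact_homology_mulLeft (x : R) (L : ChainComplex (ModuleCat.{u} R) ℕ) :
    ∃ (f : ∀ n, L.homology n →ₗ[R] (endoComplex (LinearMap.mulLeft R x) ⊗ L).homology n)
      (g : ∀ n, (endoComplex (LinearMap.mulLeft R x) ⊗ L).homology (n + 1) →ₗ[R] L.homology n),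
      Function.Surjective (f 0) ∧
      ∀ n, (∀ v, f n v = 0 ↔ ∃ w, x • w = v) ∧
        LinearMap.range (f (n + 1)) = LinearMap.ker (g n) ∧
        (∀ v, x • v = 0 ↔ ∃ w, g n w = v) := by
  obtain ⟨f, g, h₀, h⟩ := exists_exact_homology L (Module.Basis.singleton Unit R)
    (LinearMap.mulLeft R x)
  have hA (N : Type u) [AddCommGroup N] [Module R N] (v : Unit → N) :
      matAct N (LinearMap.toMatrix (Module.Basis.singleton Unit R)
        (Module.Basis.singleton Unit R) (LinearMap.mulLeft R x)) v = x • v := by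
    funext i
    rw [matAct.apply, Fintype.sum_unique, LinearMap.toMatrix_apply]
    simp [Subsingleton.elim i default]
  let e (n : ℕ) := LinearEquiv.funUnique Unit R (L.homology n)
  refine ⟨fun n => f n ∘ₗ (e n).symm, fun n => e n ∘ₗ g n, h₀.comp (e 0).symm.surjective,
    fun n => ⟨fun v => ?_, ?_, fun v => ?_⟩⟩
  · obtain ⟨v, rfl⟩ := (e n).surjective v
    rw [LinearMap.comp_apply, LinearEquiv.coe_coe, LinearEquiv.symm_apply_apply,
      ← LinearMap.mem_ker, (h n).1]
    constructor
    · rintro ⟨w, hw⟩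
      exact ⟨e n w, by rw [← map_smul, ← hA, hw]⟩
    · rintro ⟨w, hw⟩
      obtain ⟨w, rfl⟩ := (e n).surjective w
      rw [← map_smul] at hw
      exact ⟨w, by rw [hA, (e n).injective hw]⟩
  · rw [LinearMap.range_comp_of_range_eq_top _ (LinearEquiv.range _),
      LinearMap.ker_comp_of_ker_eq_bot _ (LinearEquiv.ker _), (h n).2.1]
  · obtain ⟨v, rfl⟩ := (e n).surjective v
    rw [← map_smul, LinearEquiv.map_eq_zero_iff, ← hA, ← LinearMap.mem_ker, ← (h n).2.2]
    constructor
    · rintro ⟨w, rfl⟩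
      exact ⟨w, rfl⟩
    · rintro ⟨w, hw⟩
      exact ⟨w, (e n).injective hw⟩

namespace IsConeOfDet

variable {K : ChainComplex (ModuleCat.{u} R) ℕ} {x : R} (hK : IsConeOfDet K x)
  {L : ChainComplex (ModuleCat.{u} R) ℕ}
include hK

lemma finite_homology [IsNoetherianRing R] (hL : ∀ n, Module.Finite R (L.homology n)) (n : ℕ) :
    Module.Finite R ((K ⊗ L).homology n) := by
  obtain ⟨m, A, hA, hKA⟩ := hK
  obtain ⟨f, g, h₀, h⟩ := hKA L
  match n with
  | 0 => exact Module.Finite.of_surjective (f 0) h₀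
  | n + 1 =>
    have : Module.Finite R (_ ⧸ LinearMap.range (f (n + 1))) := by
      rw [(h n).2.1]
      exact Module.Finite.equiv (g n).quotKerEquivRange.symm
    exact Module.Finite.of_submodule_quotient (LinearMap.range (f (n + 1)))

lemma subsingleton_homology {N : ℕ} (hL : ∀ n, N < n → Subsingleton (L.homology n)) {n : ℕ}
    (hn : N + 1 < n) : Subsingleton ((K ⊗ L).homology n) := by
  obtain ⟨m, A, hA, hKA⟩ := hK
  obtain ⟨f, g, h₀, h⟩ := hKA L
  match n with
  | n + 1 =>
    have := hL n (by lia)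
    have := hL (n + 1) (by lia)
    refine subsingleton_of_forall_eq 0 fun v => ?_
    have hv : v ∈ LinearMap.range (f (n + 1)) := by
      rw [(h n).2.1]
      exact Subsingleton.elim _ _
    obtain ⟨w, rfl⟩ := hv
    rw [Subsingleton.elim w 0, map_zero]

lemma mem_radical_annihilator (n : ℕ) {r : R}
    (hr : ∀ n, r ∈ (Module.annihilator R (L.homology n)).radical) :
    r ∈ (Module.annihilator R ((K ⊗ L).homology n)).radical := by
  obtain ⟨m, A, hA, hKA⟩ := hK
  obtain ⟨f, g, h₀, h⟩ := hKA L
  match n with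
  | 0 =>
    obtain ⟨a, ha⟩ := hr 0
    refine ⟨a, Module.mem_annihilator.2 fun v => ?_⟩
    obtain ⟨v, rfl⟩ := h₀ v
    rw [← map_smul, show r ^ a • v = 0 from funext fun i => Module.mem_annihilator.1 ha _, map_zero]
  | n + 1 =>
    obtain ⟨a, ha⟩ := hr (n + 1)
    obtain ⟨b, hb⟩ := hr n
    refine ⟨a + b, Module.mem_annihilator.2 fun v => ?_⟩
    have hv : r ^ b • v ∈ LinearMap.range (f (n + 1)) := by
      rw [(h n).2.1, LinearMap.mem_ker, map_smul]
      exact funext fun i => Module.mem_annihilator.1 hb _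
    obtain ⟨w, hw⟩ := hv
    rw [pow_add, mul_smul, ← hw, ← map_smul,
      show r ^ a • w = 0 from funext fun i => Module.mem_annihilator.1 ha _, map_zero]

/-- The determinant kills both ends of the extension, so its square kills the middle. -/
lemma det_mem_radical_annihilator (n : ℕ) :
    x ∈ (Module.annihilator R ((K ⊗ L).homology n)).radical := by
  obtain ⟨m, A, rfl, hKA⟩ := hK
  obtain ⟨f, g, h₀, h⟩ := hKA L
  have hf (n : ℕ) (v) : A.det • f n v = 0 := by
    rw [← map_smul, ← LinearMap.mem_ker, (h n).1]
    exact matAct.det_smul_mem_range A v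
  match n with
  | 0 =>
    refine ⟨1, Module.mem_annihilator.2 fun v => ?_⟩
    obtain ⟨v, rfl⟩ := h₀ v
    rw [pow_one, hf]
  | n + 1 =>
    refine ⟨2, Module.mem_annihilator.2 fun v => ?_⟩
    have hg : g n v ∈ LinearMap.ker (matAct _ A) := (h n).2.2 ▸ ⟨v, rfl⟩
    have hv : A.det • v ∈ LinearMap.range (f (n + 1)) := by
      rw [(h n).2.1, LinearMap.mem_ker, map_smul]
      exact matAct.det_smul_eq_zero A hg
    obtain ⟨w, hw⟩ := hv
    rw [pow_two, mul_smul, ← hw, hf]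

lemma annihilator_homology_zero_le [Module.Finite R (L.homology 0)] {p : Ideal R} [p.IsPrime]
    (hL : Module.annihilator R (L.homology 0) ≤ p) (hx : x ∈ p) :
    Module.annihilator R ((K ⊗ L).homology 0) ≤ p := by
  obtain ⟨m, A, rfl, hKA⟩ := hK
  obtain ⟨f, g, h₀, h⟩ := hKA L
  refine le_trans (fun r hr => ?_) (annihilator_coker_matAct_le A hL hx)
  rw [Module.mem_annihilator] at hr ⊢
  intro v
  obtain ⟨v, rfl⟩ := Submodule.mkQ_surjective _ v
  rw [← map_smul]
  refine (Submodule.Quotient.mk_eq_zero _).2 ?_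
  rw [← (h 0).1, LinearMap.mem_ker, map_smul, hr]

end IsConeOfDet

/-- The kernel in degree n contributes to homology in degree n + 1, hence with the opposite sign;
truncation leaves one unpaired cokernel at the top. -/
lemma sum_range_alternating_extension (c k h : ℕ → ℤ) (h₀ : h 0 = c 0)
    (hs : ∀ n, h (n + 1) = c (n + 1) + k n) (N : ℕ) :
    ∑ n ∈ Finset.range (N + 1), (-1) ^ n * h n =
      ∑ n ∈ Finset.range N, (-1) ^ n * (c n - k n) + (-1) ^ N * c N := by
  induction N with
  | zero => simp [h₀]
  | succ N ih =>
    rw [Finset.sum_range_succ, ih, Finset.sum_range_succ _ N, hs]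
    ring

lemma eulerPoincareChar_eq_sum {K : ChainComplex (ModuleCat.{u} R) ℕ} {N : ℕ}
    (hK : ∀ n, N ≤ n → Subsingleton (K.homology n)) :
    eulerPoincareChar K =
      ∑ n ∈ Finset.range N, (-1 : ℤ) ^ n * ((Module.length R (K.homology n)).toNat : ℤ) := by
  refine finsum_eq_sum_of_support_subset _ fun n hn => ?_
  rw [Finset.coe_range, Set.mem_Iio]
  by_contra hN
  have := hK n (not_lt.1 hN)
  exact hn (by simp [Module.length_eq_zero])

lemma nonempty_homologyEquiv_of_iso {K L : ChainComplex (ModuleCat.{u} R) ℕ} (e : K ≅ L) (n : ℕ) :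
    Nonempty (K.homology n ≃ₗ[R] L.homology n) :=
  ⟨((HomologicalComplex.homologyFunctor _ _ n).mapIso e).toLinearEquiv⟩

lemma eulerPoincareChar_eq_of_iso {K L : ChainComplex (ModuleCat.{u} R) ℕ} (e : K ≅ L) :
    eulerPoincareChar K = eulerPoincareChar L := by
  refine finsum_congr fun n => ?_
  rw [(nonempty_homologyEquiv_of_iso e n).some.length_eq]

variable [IsLocalRing R] [IsNoetherianRing R]

lemma IsMatrixCone.eulerPoincareChar_eq {K L : ChainComplex (ModuleCat.{u} R) ℕ} {m : ℕ}
    {A : Matrix (Fin m) (Fin m) R} (hK : IsMatrixCone K A)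
    (hL : ∀ n, Module.Finite R (L.homology n)) {N : ℕ}
    (hN : ∀ n, N < n → Subsingleton (L.homology n))
    (h : ∀ n, ∀ p : Ideal R, p.IsPrime → Module.annihilator R (L.homology n) ≤ p → A.det ∈ p →
      p = IsLocalRing.maximalIdeal R) :
    eulerPoincareChar (K ⊗ L) =
      ∑ n ∈ Finset.range (N + 1), (-1 : ℤ) ^ n * (matAct (L.homology n) A).lengthIndex := by
  have hK' : IsConeOfDet K A.det := ⟨m, A, rfl, hK⟩
  obtain ⟨f, g, h₀, hfg⟩ := hK L
  let c (n : ℕ) := Module.length R ((Fin m → L.homology n) ⧸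
    LinearMap.range (matAct (L.homology n) A))
  let k (n : ℕ) := Module.length R (LinearMap.ker (matAct (L.homology n) A))
  have hf (n : ℕ) : Module.length R (LinearMap.range (f n)) = c n := by
    rw [← (f n).quotKerEquivRange.length_eq, (hfg n).1]
  rw [eulerPoincareChar_eq_sum (N := N + 1 + 1), sum_range_alternating_extension
    (fun n => ((c n).toNat : ℤ)) (fun n => ((k n).toNat : ℤ))]
  -- The unpaired top cokernel vanishes because L has no homology in degree N + 1.
  · have : c (N + 1) = 0 := by
      have := hN (N + 1) N.lt_succ_self
      exact Module.length_eq_zero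
    simp only [this]
    simp [LinearMap.lengthIndex, c, k]
  · rw [← hf, length_range_of_surjective h₀]
  · intro n
    rw [Module.length_eq_add_of_exact (LinearMap.range (f (n + 1))).subtype (g n).rangeRestrict
      (Submodule.subtype_injective _) (g n).surjective_rangeRestrict, hf, (hfg n).2.2,
      ENat.toNat_add, Nat.cast_add]
    · exact Module.length_ne_top_iff.2 (isFiniteLength_coker_matAct A (h _))
    · exact Module.length_ne_top_iff.2 (isFiniteLength_ker_matAct A (h _))
    · rw [LinearMap.exact_iff, LinearMap.ker_rangeRestrict, Submodule.range_subtype, (hfg n).2.1]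
  · exact fun n hn => hK'.subsingleton_homology hN (by lia)

end
end

/-! ### Iterated tensor products, Koszul complexes and the Cohen–Macaulay case. -/

noncomputable section

section

variable {R : Type u} [CommRing R]

namespace foldTensor

/-- The homology in degree `0` of the empty tensor product. -/
def nilHomologyEquiv : (foldTensor (R := R) []).homology 0 ≃ₗ[R] R :=
  (HomologicalComplex.singleObjHomologySelfIso (ComplexShape.down ℕ) 0
    (𝟙_ (ModuleCat.{u} R))).toLinearEquiv

lemma subsingleton_homology_nil {n : ℕ} (hn : 0 < n) :
    Subsingleton ((foldTensor (R := R) []).homology n) :=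
  ModuleCat.subsingleton_of_isZero ((HomologicalComplex.exactAt_iff_isZero_homology _ _).1
    (HomologicalComplex.exactAt_single_obj (ComplexShape.down ℕ) 0 (𝟙_ (ModuleCat.{u} R)) n hn.ne'))

variable {ls ls' ds : List (ChainComplex (ModuleCat.{u} R) ℕ)} {xs ys : List R}

lemma finite_homology [IsNoetherianRing R] (h : List.Forall₂ IsConeOfDet ls xs) (n : ℕ) :
    Module.Finite R ((foldTensor ls).homology n) := by
  induction h generalizing n with
  | nil =>
    match n with
    | 0 => exact Module.Finite.equiv nilHomologyEquiv.symm
    | n + 1 =>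
      have := subsingleton_homology_nil (R := R) n.succ_pos
      infer_instance
  | cons hK _ ih => exact hK.finite_homology ih n

lemma subsingleton_homology_append (h : List.Forall₂ IsConeOfDet ls xs) {N : ℕ}
    (hN : ∀ n, N < n → Subsingleton ((foldTensor ds).homology n)) {n : ℕ} (hn : N + xs.length < n) :
    Subsingleton ((foldTensor (ls ++ ds)).homology n) := by
  induction h generalizing n with
  | nil => exact hN n hn
  | @cons K x ls xs hK _ ih =>
    exact hK.subsingleton_homology (N := N + xs.length) (fun _ => ih) (by simpa [add_assoc] using hn)

lemma subsingleton_homology (h : List.Forall₂ IsConeOfDet ls xs) {n : ℕ} (hn : xs.length < n) :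
    Subsingleton ((foldTensor ls).homology n) := by
  rw [← List.append_nil ls]
  exact subsingleton_homology_append h (fun _ => subsingleton_homology_nil) (by simpa using hn)

lemma mem_radical_annihilator_append (h : List.Forall₂ IsConeOfDet ls xs) {r : R}
    (hr : ∀ n, r ∈ (Module.annihilator R ((foldTensor ds).homology n)).radical) (n : ℕ) :
    r ∈ (Module.annihilator R ((foldTensor (ls ++ ds)).homology n)).radical := by
  induction h generalizing n with
  | nil => exact hr n
  | cons hK _ ih => exact hK.mem_radical_annihilator n ih

lemma mem_radical_annihilator (h : List.Forall₂ IsConeOfDet ls xs) {x : R} (hx : x ∈ xs) (n : ℕ) :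
    x ∈ (Module.annihilator R ((foldTensor ls).homology n)).radical := by
  induction h generalizing n with
  | nil => simp at hx
  | cons hK _ ih =>
    rcases List.mem_cons.1 hx with rfl | hx
    · exact hK.det_mem_radical_annihilator n
    · exact hK.mem_radical_annihilator n (ih hx)

lemma annihilator_homology_zero_le [IsNoetherianRing R] (h : List.Forall₂ IsConeOfDet ls xs)
    {p : Ideal R} [p.IsPrime] (hp : ∀ x ∈ xs, x ∈ p) :
    Module.annihilator R ((foldTensor ls).homology 0) ≤ p := by
  induction h with
  | nil =>
    rw [LinearEquiv.annihilator_eq nilHomologyEquiv,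
      (Module.annihilator_eq_bot (R := R) (M := R)).2 inferInstance]
    exact bot_le
  | @cons K x ls xs hK h ih =>
    have : Module.Finite R ((foldTensor ls).homology 0) := finite_homology h 0
    exact hK.annihilator_homology_zero_le (L := foldTensor ls)
      (ih fun x hx => hp x (List.mem_cons_of_mem _ hx))
      (hp _ List.mem_cons_self)

/-- All homology is supported on V(xs), and H_0 has all of V(xs) in its support. -/
theorem isFiniteLength_homology_iff [IsLocalRing R] [IsNoetherianRing R]
    (h : List.Forall₂ IsConeOfDet ls xs) :
    HasFiniteLengthHomology (foldTensor ls) ↔ IsFiniteLength R (R ⧸ Ideal.ofList xs) := by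
  have := finite_homology h
  rw [isFiniteLength_quotient_iff]
  constructor
  · intro h' p hp hle
    exact isFiniteLength_iff_forall_prime.1 (h' 0) p hp
      (annihilator_homology_zero_le h fun x hx => hle (Ideal.subset_span hx))
  · intro h' n
    refine isFiniteLength_iff_forall_prime.2 fun p hp hle => h' p hp (Ideal.span_le.2 fun x hx => ?_)
    exact hp.radical_le_iff.2 hle (mem_radical_annihilator h hx n)

end foldTensor

open foldTensor

lemma IsConeOfDet.eulerPoincareChar_tensor_eq [IsLocalRing R] [IsNoetherianRing R]
    {K K' L : ChainComplex (ModuleCat.{u} R) ℕ} {x : R} (hK : IsConeOfDet K x)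
    (hK' : IsConeOfDet K' x) (hL : ∀ n, Module.Finite R (L.homology n)) {N : ℕ}
    (hN : ∀ n, N < n → Subsingleton (L.homology n))
    (h : ∀ n, ∀ p : Ideal R, p.IsPrime → Module.annihilator R (L.homology n) ≤ p → x ∈ p →
      p = IsLocalRing.maximalIdeal R) :
    eulerPoincareChar (K ⊗ L) = eulerPoincareChar (K' ⊗ L) := by
  obtain ⟨m, A, rfl, hA⟩ := hK
  obtain ⟨n, B, hB, hKB⟩ := hK'
  rw [hA.eulerPoincareChar_eq hL hN h, hKB.eulerPoincareChar_eq hL hN (by rwa [hB])]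
  exact Finset.sum_congr rfl fun i _ => by rw [lengthIndex_matAct_eq A B hB.symm (h i)]

/-- Exchange the leading factor, then move the new one into the tail `ds`. The primes to control
stay the same, since xs and ys are only redistributed. -/
theorem eulerPoincareChar_foldTensor_append_eq [IsLocalRing R] [IsNoetherianRing R]
    {ls ls' ds : List (ChainComplex (ModuleCat.{u} R) ℕ)} {xs ys : List R}
    (h : List.Forall₂ IsConeOfDet ls xs) (h' : List.Forall₂ IsConeOfDet ls' xs)
    (hd : List.Forall₂ IsConeOfDet ds ys)
    (hp : ∀ p : Ideal R, p.IsPrime → (∀ x ∈ xs ++ ys, x ∈ p) → p = IsLocalRing.maximalIdeal R) :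
    eulerPoincareChar (foldTensor (ls ++ ds)) = eulerPoincareChar (foldTensor (ls' ++ ds)) := by
  induction h generalizing ls' ds ys with
  | nil => rw [List.forall₂_nil_right_iff.1 h']
  | @cons K x ls xs hK h ih =>
    obtain ⟨K', ls', hK', h'', rfl⟩ := List.forall₂_cons_right_iff.1 h'
    have hld := List.rel_append h hd
    have hswap (l : List (ChainComplex (ModuleCat.{u} R) ℕ)) :
        eulerPoincareChar (foldTensor (l ++ K' :: ds)) =
          eulerPoincareChar (foldTensor (K' :: (l ++ ds))) :=
      eulerPoincareChar_eq_of_iso (foldTensor_perm List.perm_middle).some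
    have h₁ : eulerPoincareChar (foldTensor (K :: (ls ++ ds))) =
        eulerPoincareChar (foldTensor (K' :: (ls ++ ds))) := by
      -- The remaining factors alone need not have finite-length homology; it suffices that the part
      -- of the support where x vanishes is the closed point.
      refine hK.eulerPoincareChar_tensor_eq hK' (finite_homology hld)
        (fun n => subsingleton_homology hld) fun n p hpp hle hx => hp p hpp ?_
      intro y hy
      rcases List.mem_cons.1 hy with rfl | hy
      · exact hx
      · exact hpp.radical_le_iff.2 hle (mem_radical_annihilator hld hy n)
    rw [List.cons_append, List.cons_append, h₁, ← hswap, ← hswap]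
    refine ih h'' (hd.cons hK') fun p hpp hx => hp p hpp fun y hy => hx y ?_
    simpa [or_left_comm, or_assoc] using hy

/-- The Koszul complex of a list of elements. -/
def koszulList (xs : List R) : ChainComplex (ModuleCat.{u} R) ℕ :=
  foldTensor (xs.map fun x => endoComplex (LinearMap.mulLeft R x))

lemma forall₂_isConeOfDet_map [Nontrivial R] (xs : List R) :
    List.Forall₂ IsConeOfDet (xs.map fun x => endoComplex (LinearMap.mulLeft R x)) xs := by
  rw [List.forall₂_map_left_iff, List.forall₂_same]
  exact fun x _ => endoComplex.isConeOfDet_mulLeft x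

lemma koszulList.exists_surjective_homology_zero (xs : List R) :
    ∃ f : R →ₗ[R] (koszulList xs).homology 0,
      Function.Surjective f ∧ LinearMap.ker f = Ideal.ofList xs := by
  induction xs with
  | nil =>
    refine ⟨nilHomologyEquiv.symm.toLinearMap, nilHomologyEquiv.symm.surjective, ?_⟩
    rw [Ideal.ofList_nil]
    exact LinearEquiv.ker _
  | cons x xs ih =>
    obtain ⟨f, hf, hker⟩ := ih
    obtain ⟨F, g, hF, h⟩ := endoComplex.exists_exact_homology_mulLeft x (koszulList xs)
    refine ⟨F 0 ∘ₗ f, hF.comp hf, ?_⟩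
    ext r
    rw [Ideal.ofList_cons, Ideal.mem_span_singleton_sup]
    change F 0 (f r) = 0 ↔ _
    rw [(h 0).1]
    constructor
    · rintro ⟨w, hw⟩
      obtain ⟨s, rfl⟩ := hf w
      refine ⟨s, r - s * x, ?_, by ring⟩
      rw [← hker, LinearMap.mem_ker, map_sub, ← hw, mul_comm, ← smul_eq_mul, map_smul, sub_self]
    · rintro ⟨s, t, ht, rfl⟩
      rw [← hker, LinearMap.mem_ker] at ht
      exact ⟨f s, by rw [map_add, ht, add_zero, mul_comm, ← smul_eq_mul, map_smul]⟩

/-- Regularity of the last element is modulo the previous ones, so the induction runs from the end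
of the list, while the cone is taken on the first factor; a permutation reconciles the two. -/
lemma koszulList.subsingleton_homology_of_isWeaklyRegular {xs : List R}
    (h : RingTheory.Sequence.IsWeaklyRegular R xs) {n : ℕ} (hn : 0 < n) :
    Subsingleton ((koszulList xs).homology n) := by
  induction xs using List.reverseRecOn generalizing n with
  | nil => exact subsingleton_homology_nil hn
  | append_singleton xs x ih =>
    have hx : IsSMulRegular (R ⧸ Ideal.ofList xs) x := by
      have := h.regular_mod_prev xs.length (by simp)
      rwa [List.take_left, List.getElem_concat_length rfl, smul_eq_mul, Ideal.mul_top] at this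
    replace ih {n : ℕ} (hn : 0 < n) := ih
      ⟨fun i hi => by
        have := h.regular_mod_prev i (by simp; lia)
        rwa [List.take_append_of_le_length hi.le, List.getElem_append_left hi] at this⟩ hn
    obtain ⟨F, hF, hker⟩ := exists_surjective_homology_zero xs
    obtain ⟨f, g, -, hfg⟩ := endoComplex.exists_exact_homology_mulLeft x (koszulList xs)
    have e := (foldTensor_perm ((List.perm_append_singleton x xs).map
      fun x => endoComplex (LinearMap.mulLeft R x))).some
    obtain ⟨e⟩ := nonempty_homologyEquiv_of_iso e n
    have : Subsingleton
        ((endoComplex (LinearMap.mulLeft R x) ⊗ koszulList xs).homology n) := by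
      obtain ⟨n, rfl⟩ := Nat.exists_eq_succ_of_ne_zero hn.ne'
      have := ih n.succ_pos
      refine subsingleton_of_forall_eq 0 fun v => ?_
      have hv : g n v = 0 := by
        match n with
        | n + 1 =>
          have := ih n.succ_pos
          exact Subsingleton.elim _ _
        -- In degree 1 the image of g is the kernel of x on H_0 = R/(xs), which is zero by
        -- regularity.
        | 0 =>
          obtain ⟨r, hr⟩ := hF (g 0 v)
          have h₁ := ((hfg 0).2.2 (g 0 v)).2 ⟨v, rfl⟩
          rw [← hr, ← map_smul, ← LinearMap.mem_ker, hker, ← Ideal.Quotient.eq_zero_iff_mem] at h₁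
          have h₂ : Ideal.Quotient.mk (Ideal.ofList xs) r = 0 := hx (by
            change x • Ideal.Quotient.mk (Ideal.ofList xs) r = x • 0
            rw [smul_zero]
            exact h₁)
          rw [Ideal.Quotient.eq_zero_iff_mem, ← hker, LinearMap.mem_ker] at h₂
          rw [← hr, h₂]
      rw [← LinearMap.mem_ker, ← (hfg n).2.1] at hv
      obtain ⟨w, rfl⟩ := hv
      rw [Subsingleton.elim w 0, map_zero]
    have h' : Subsingleton ((foldTensor (List.map
        (fun x => endoComplex (LinearMap.mulLeft R x)) (x :: xs))).homology n) := this
    exact e.toEquiv.subsingleton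

lemma exists_ne_zero_smul_eq_zero {M : Type*} [AddCommGroup M] [Module R M] [Nontrivial M] {y : R}
    (hy : y ∈ (Module.annihilator R M).radical) : ∃ v : M, v ≠ 0 ∧ y • v = 0 := by
  obtain ⟨k, hk⟩ := hy
  by_contra! h
  obtain ⟨v, hv⟩ := exists_ne (0 : M)
  have (k : ℕ) : y ^ k • v ≠ 0 := by
    induction k with
    | zero => simpa
    | succ k ih =>
      rw [pow_succ', mul_smul]
      exact h _ ih
  exact this k (Module.mem_annihilator.1 hk v)

/-- A nilpotent y has a nonzero kernel on nonzero homology, and the next homology module of the cone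
maps onto that kernel. -/
lemma nontrivial_homology_foldTensor_append [Nontrivial R]
    {ls : List (ChainComplex (ModuleCat.{u} R) ℕ)} {ys : List R} {i : ℕ}
    (hi : Nontrivial ((foldTensor ls).homology i))
    (hy : ∀ y ∈ ys, ∀ n, y ∈ (Module.annihilator R ((foldTensor ls).homology n)).radical) :
    Nontrivial ((foldTensor
      ((ys.map fun y => endoComplex (LinearMap.mulLeft R y)) ++ ls)).homology (i + ys.length)) := by
  induction ys with
  | nil => exact hi
  | cons y ys ih =>
    have := ih fun z hz => hy z (List.mem_cons_of_mem _ hz)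
    obtain ⟨v, hv, hyv⟩ := exists_ne_zero_smul_eq_zero
      (mem_radical_annihilator_append (forall₂_isConeOfDet_map ys) (hy y List.mem_cons_self)
        (i + ys.length))
    obtain ⟨f, g, -, h⟩ := endoComplex.exists_exact_homology_mulLeft y
      (foldTensor ((ys.map fun y => endoComplex (LinearMap.mulLeft R y)) ++ ls))
    obtain ⟨w, rfl⟩ := ((h _).2.2 v).1 hyv
    exact nontrivial_of_ne w 0 fun hw => hv (hw ▸ map_zero (g _))

/-- Both orders of tensoring compute the same homology in degree i + |ys|: it is nonzero seen as
K(ys) applied to `ls`, and zero seen as |xs| ≤ |ys| cones over a complex with homology only in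
degree 0. -/
theorem subsingleton_homology_foldTensor_of_isWeaklyRegular [IsLocalRing R]
    {ls : List (ChainComplex (ModuleCat.{u} R) ℕ)} {xs ys : List R}
    (h : List.Forall₂ IsConeOfDet ls xs) (hf : HasFiniteLengthHomology (foldTensor ls))
    (hym : ∀ y ∈ ys, y ∈ IsLocalRing.maximalIdeal R)
    (hyr : RingTheory.Sequence.IsWeaklyRegular R ys) (hl : xs.length ≤ ys.length) {i : ℕ}
    (hi : 0 < i) : Subsingleton ((foldTensor ls).homology i) := by
  by_contra hs
  rw [not_subsingleton_iff_nontrivial] at hs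
  have h₁ := nontrivial_homology_foldTensor_append hs
    fun y hy n => (hf n).exists_pow_mem_annihilator (hym y hy)
  obtain ⟨e⟩ := nonempty_homologyEquiv_of_iso (foldTensor_perm (List.perm_append_comm (l₁ := ls)
    (l₂ := ys.map fun y => endoComplex (LinearMap.mulLeft R y)))).some (i + ys.length)
  have h₂ := subsingleton_homology_append (N := 0) h
    (fun n => koszulList.subsingleton_homology_of_isWeaklyRegular hyr)
    (show 0 + xs.length < i + ys.length by lia)
  exact not_subsingleton_iff_nontrivial.2 h₁ e.symm.toEquiv.subsingleton

lemma exists_isWeaklyRegular_of_le_localRingDepth [IsLocalRing R] {q : ℕ}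
    (h : (q : ℕ∞) ≤ localRingDepth R) :
    ∃ ys : List R, (∀ y ∈ ys, y ∈ IsLocalRing.maximalIdeal R) ∧
      RingTheory.Sequence.IsWeaklyRegular R ys ∧ q ≤ ys.length := by
  match q with
  | 0 => exact ⟨[], by simp, ⟨by simp⟩, le_rfl⟩
  | q + 1 =>
    -- From q < q + 1 ≤ depth some sequence has length above q, so attainment of the supremum is not
    -- needed; q = 0 is separate because it has no predecessor.
    obtain ⟨ys, hys⟩ := lt_iSup_iff.1 (lt_of_lt_of_le (Nat.cast_lt.2 q.lt_succ_self) h)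
    exact ⟨ys.1, ys.2.1, ys.2.2.1, Nat.cast_lt.1 hys⟩

lemma isAcyclicInPosDegrees_iff {K : ChainComplex (ModuleCat.{u} R) ℕ} :
    IsAcyclicInPosDegrees K ↔ ∀ i, 0 < i → Subsingleton (K.homology i) :=
  forall₂_congr fun i _ => by
    rw [HomologicalComplex.exactAt_iff_isZero_homology, ModuleCat.isZero_iff_subsingleton]

lemma IsAcyclicInPosDegrees.eulerPoincareChar_eq {K : ChainComplex (ModuleCat.{u} R) ℕ}
    (hK : IsAcyclicInPosDegrees K) :
    eulerPoincareChar K = (Module.length R (K.homology 0)).toNat := by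
  rw [eulerPoincareChar_eq_sum (N := 1) (isAcyclicInPosDegrees_iff.1 hK)]
  simp

end
end

/-! ### The theorem. -/

theorem mainTheorem7 {R : Type u} [CommRing R] [IsLocalRing R] [IsNoetherianRing R]
    {q : ℕ} (F : Fin q → Type u) [∀ k, AddCommGroup (F k)] [∀ k, Module R (F k)]
    [∀ k, Module.Free R (F k)] [∀ k, Module.Finite R (F k)]
    (φ : ∀ k, F k →ₗ[R] F k) :
    (HasFiniteLengthHomology (tensorEndoComplex φ) ↔
      IsFiniteLength R (R ⧸ Ideal.span (Set.range fun k => LinearMap.det (φ k)))) ∧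
    (IsFiniteLength R (R ⧸ Ideal.span (Set.range fun k => LinearMap.det (φ k))) →
      HasFiniteLengthHomology (koszulComplex fun k => LinearMap.det (φ k)) ∧
      eulerPoincareChar (tensorEndoComplex φ) =
        eulerPoincareChar (koszulComplex fun k => LinearMap.det (φ k)) ∧
      (IsCohenMacaulayLocal R → ringKrullDim R = q →
        IsAcyclicInPosDegrees (tensorEndoComplex φ) ∧
        IsAcyclicInPosDegrees (koszulComplex fun k => LinearMap.det (φ k)) ∧
        Module.length R ((tensorEndoComplex φ).homology 0) =
          Module.length R
            (R ⧸ Ideal.span (Set.range fun k => LinearMap.det (φ k))))) := by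
  let xs := List.ofFn fun k => LinearMap.det (φ k)
  let ls := List.ofFn fun k => endoComplex (φ k)
  have hls : List.Forall₂ IsConeOfDet ls xs := by
    rw [List.forall₂_iff_get]
    refine ⟨by simp [ls, xs], fun i h₁ h₂ => ?_⟩
    simpa [ls, xs] using endoComplex.isConeOfDet (φ _)
  have hks := forall₂_isConeOfDet_map xs
  have hspan : Ideal.span (Set.range fun k => LinearMap.det (φ k)) = Ideal.ofList xs := by
    rw [Ideal.ofList]
    congr 1
    ext r
    simp [xs, List.mem_ofFn]
  have hkos : koszulComplex (fun k => LinearMap.det (φ k)) = koszulList xs := by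
    rw [koszulList, List.map_ofFn]
    rfl
  rw [hspan, hkos]
  change (HasFiniteLengthHomology (foldTensor ls) ↔ _) ∧ (_ → _ ∧
    eulerPoincareChar (foldTensor ls) = _ ∧ (_ → _ → IsAcyclicInPosDegrees (foldTensor ls) ∧ _ ∧
      Module.length R ((foldTensor ls).homology 0) = _))
  refine ⟨foldTensor.isFiniteLength_homology_iff hls, fun h => ?_⟩
  have hfl := (foldTensor.isFiniteLength_homology_iff hls).2 h
  have hfk := (foldTensor.isFiniteLength_homology_iff hks).2 h
  have hχ : eulerPoincareChar (foldTensor ls) = eulerPoincareChar (koszulList xs) := by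
    have := eulerPoincareChar_foldTensor_append_eq hls hks .nil fun p hp hle =>
      (isFiniteLength_quotient_iff _).1 h p hp (Ideal.span_le.2 fun x hx => hle x (by simpa using hx))
    rwa [List.append_nil, List.append_nil] at this
  refine ⟨hfk, hχ, fun hcm hq => ?_⟩
  obtain ⟨ys, hym, hyr, hl⟩ := exists_isWeaklyRegular_of_le_localRingDepth (R := R) (q := q)
    (WithBot.coe_le_coe.1 (hcm.trans hq).ge)
  have hlen : xs.length ≤ ys.length := by simpa [xs] using hl
  have hal : IsAcyclicInPosDegrees (foldTensor ls) := isAcyclicInPosDegrees_iff.2 fun i =>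
    subsingleton_homology_foldTensor_of_isWeaklyRegular hls hfl hym hyr hlen
  have hak : IsAcyclicInPosDegrees (koszulList xs) := isAcyclicInPosDegrees_iff.2 fun i =>
    subsingleton_homology_foldTensor_of_isWeaklyRegular hks hfk hym hyr hlen
  refine ⟨hal, hak, ?_⟩
  obtain ⟨f, hf, hker⟩ := koszulList.exists_surjective_homology_zero xs
  rw [← hker, (f.quotKerEquivOfSurjective hf).length_eq]
  -- Both characteristics reduce to lengths of H_0; these are finite, so equality of `toNat` gives
  -- equality of lengths.
  rw [hal.eulerPoincareChar_eq, hak.eulerPoincareChar_eq, Nat.cast_inj] at hχ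
  rw [← ENat.natCast_toNat (Module.length_ne_top_iff.2 (hfl 0)), hχ,
    ENat.natCast_toNat (Module.length_ne_top_iff.2 (hfk 0) :
      Module.length R ((koszulList xs).homology 0) ≠ ⊤)]
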